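/- Let $\chi$ be a primitive Dirichlet character of conductor $N$ that is non-principal. Put $k=0$ if $\chi(-1)=1$ and $k=1$ if $\chi(-1)=-1$, and let $$\xi(s,\chi) := \left(\frac{\pi}{N}\right)^{-\frac{s+k}{2}}\Gamma\left(\frac{s+k}{2}\right)L(s,\chi),$$ an entire function of $s$ (after analytic continuation and removal of the removable singularities). For real $h$ and $\theta$ put $$E_{h,\theta}(s,\chi) := e^{i\theta}\,\xi(s+h,\chi),$$ $$A_{h,\theta}(s,\chi) := \tfrac12\left(E_{h,\theta}(s,\chi)+\overline{E_{h,\theta}(1-\bar s,\chi)}\right),\qquad B_{h,\theta}(s,\chi) := -\tfrac1{2i}\left(E_{h,\theta}(s,\chi)-\overline{E_{h,\theta}(1-\bar s,\chi)}\right),$$ so that $E_{h,\theta}=A_{h,\theta}-iB_{h,\theta}$. (1) For $|h|\ge \frac12$ and any $\theta$, the functions $A_{h,\theta}(s,\chi)$ and $B_{h,\theta}(s,\chi)$ are entire and have all their zeros on the critical line $\Re(s)=\frac12$. These zeros are all simple zeros, and they interlace. (2) Assume the Riemann hypothesis for $L(s,\chi)$, i.e. that every zero of $L(s,\chi)$ with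 $0<\Re(s)<1$ satisfies $\Re(s)=\frac12$. Then for $0<|h|<\frac12$ and any $\theta$, the functions $A_{h,\theta}(s,\chi)$ and $B_{h,\theta}(s,\chi)$ are entire and have all their zeros on the critical line $\Re(s)=\frac12$. These zeros are all simple zeros, and they interlace. Here the zeros $\frac12+i\gamma$ of $A=A_{h,\theta}(\cdot,\chi)$ and $B=B_{h,\theta}(\cdot,\chi)$ interlace if their ordinates can be numbered in increasing order by integers as $\gamma_n(A)$ and $\gamma_n(B)$ so that $\gamma_n(A)<\gamma_n(B)<\gamma_{n+1}(A)$ for all allowed $n$, where no index is skipped: in the combined sequence $\dots,\gamma_n(A),\gamma_n(B),\gamma_{n+1}(A),\gamma_{n+1}(B),\dots$ the indexed positions form an interval of integers. In particular $A$ and $B$ have no common zero. -/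

import Mathlib

open scoped ComplexConjugate

namespace DifferencedL

noncomputable section

open scoped Classical in
/-- The parity of `χ`: `k = 0` if `χ(-1) = 1` and `k = 1` if `χ(-1) = -1`. -/
def parity {N : ℕ} (χ : DirichletCharacter ℂ N) : ℕ := if χ.Even then 0 else 1

/-- The completed `L`-function `ξ(s, χ) = (π / N) ^ (-(s + k) / 2) Γ((s + k) / 2) L(s, χ)`.
Mathlib's `completedLFunction χ s` is the analytically continued
`π ^ (-(s + k) / 2) Γ((s + k) / 2) L(s, χ)`, so that the removable singularities at the poles of
the Gamma factor carry the right values; see `xi_eq` and `differentiable_xi`. -/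
def xi {N : ℕ} [NeZero N] (χ : DirichletCharacter ℂ N) (s : ℂ) : ℂ :=
  (N : ℂ) ^ ((s + parity χ) / 2) * χ.completedLFunction s

/-- `ξ(s, χ)` is entire for non-principal `χ`. -/
theorem differentiable_xi {N : ℕ} [NeZero N] {χ : DirichletCharacter ℂ N} (hχ : χ ≠ 1) :
    Differentiable ℂ (xi χ) := by
  have hN : (N : ℂ) ≠ 0 := Nat.cast_ne_zero.mpr (NeZero.ne N)
  refine Differentiable.mul ?_ (DirichletCharacter.differentiable_completedLFunction hχ)
  intro s
  exact DifferentiableAt.const_cpow (by fun_prop) (Or.inl hN)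

/-- Away from the poles of the Gamma factor, `ξ(s, χ)` is given by the usual formula. -/
theorem xi_eq {N : ℕ} [NeZero N] {χ : DirichletCharacter ℂ N} (hχ : χ ≠ 1) {s : ℂ}
    (hs : ∀ m : ℕ, (s + parity χ) / 2 ≠ -m) :
    xi χ s = ((Real.pi / N : ℝ) : ℂ) ^ (-(s + parity χ) / 2) *
      Complex.Gamma ((s + parity χ) / 2) * χ.LFunction s := by
  have hN1 : N ≠ 1 := fun h => hχ (DirichletCharacter.level_one' χ h)
  have hNpos : (0 : ℝ) < N := Nat.cast_pos.mpr (NeZero.pos N)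
  have hΓ : Complex.Gamma ((s + parity χ) / 2) ≠ 0 := Complex.Gamma_ne_zero hs
  have hg : χ.gammaFactor s =
      (Real.pi : ℂ) ^ (-(s + parity χ) / 2) * Complex.Gamma ((s + parity χ) / 2) := by
    by_cases h : χ.Even
    · simp [DirichletCharacter.gammaFactor, parity, h, Complex.Gammaℝ_def]
    · simp [DirichletCharacter.gammaFactor, parity, h, Complex.Gammaℝ_def]
  have hπ : (Real.pi : ℂ) ≠ 0 := by exact_mod_cast Real.pi_ne_zero
  have hp : (Real.pi : ℂ) ^ (-(s + parity χ) / 2) ≠ 0 := by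
    simp [Complex.cpow_eq_zero_iff, hπ]
  have hdiv : ((Real.pi / N : ℝ) : ℂ) ^ (-(s + parity χ) / 2) =
      (Real.pi : ℂ) ^ (-(s + parity χ) / 2) * (N : ℂ) ^ ((s + parity χ) / 2) := by
    rw [div_eq_mul_inv, Complex.ofReal_mul,
      Complex.mul_cpow_ofReal_nonneg Real.pi_pos.le (inv_nonneg.mpr hNpos.le),
      Complex.ofReal_inv, Complex.ofReal_natCast, neg_div, Complex.cpow_neg (N : ℂ)⁻¹,
      Complex.inv_cpow _ _ (by rw [Complex.natCast_arg]; exact Real.pi_pos.ne), inv_inv]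
  rw [DirichletCharacter.LFunction_eq_completed_div_gammaFactor χ s (Or.inr hN1), hg, hdiv, xi]
  field_simp

/-- `E_{h,θ}(s, χ) = e^{iθ} ξ(s + h, χ)`. -/
def E {N : ℕ} [NeZero N] (χ : DirichletCharacter ℂ N) (h θ : ℝ) (s : ℂ) : ℂ :=
  Complex.exp (Complex.I * θ) * xi χ (s + h)

/-- `A_{h,θ}(s, χ) = (E(s) + conj (E(1 - conj s))) / 2`, where `E = E_{h,θ}(·, χ)`. -/
def A {N : ℕ} [NeZero N] (χ : DirichletCharacter ℂ N) (h θ : ℝ) (s : ℂ) : ℂ :=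
  (1 / 2) * (E χ h θ s + conj (E χ h θ (1 - conj s)))

/-- `B_{h,θ}(s, χ) = -(E(s) - conj (E(1 - conj s))) / (2i)`, where `E = E_{h,θ}(·, χ)`. -/
def B {N : ℕ} [NeZero N] (χ : DirichletCharacter ℂ N) (h θ : ℝ) (s : ℂ) : ℂ :=
  -(1 / (2 * Complex.I)) * (E χ h θ s - conj (E χ h θ (1 - conj s)))

theorem E_eq_A_sub_I_mul_B {N : ℕ} [NeZero N] (χ : DirichletCharacter ℂ N) (h θ : ℝ) (s : ℂ) :
    E χ h θ s = A χ h θ s - Complex.I * B χ h θ s := by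
  have hI : Complex.I ≠ 0 := Complex.I_ne_zero
  rw [A, B]
  field_simp
  ring

/-- The Riemann hypothesis for `L(s, χ)`: every zero in the open critical strip lies on the
critical line. -/
def RiemannHypothesisFor {N : ℕ} [NeZero N] (χ : DirichletCharacter ℂ N) : Prop :=
  ∀ s : ℂ, 0 < s.re → s.re < 1 → χ.LFunction s = 0 → s.re = 1 / 2

/-- All zeros of `f` lie on the critical line. -/
def ZerosOnCriticalLine (f : ℂ → ℂ) : Prop :=
  ∀ s : ℂ, f s = 0 → s.re = 1 / 2

/-- All zeros of `f` are simple. -/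
def ZerosSimple (f : ℂ → ℂ) : Prop :=
  ∀ s : ℂ, f s = 0 → analyticOrderAt f s = 1

/-- The set of ordinates `t` of the zeros `1/2 + it` of `f` on the critical line. -/
def zeroOrdinates (f : ℂ → ℂ) : Set ℝ :=
  {t : ℝ | f (1 / 2 + t * Complex.I) = 0}

/-- Strict interlacing of the zeros of `f` and `g` on the critical line (for functions whose zeros
are simple). The ordinates of the zeros of `f` and of `g`
can be numbered as `γ_n(f)` and `γ_n(g)`, in increasing order, so that
`γ_n(f) < γ_n(g) < γ_{n+1}(f)` for all allowed `n`.
The two numberings are merged into one strictly increasing sequence `γ` with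
`γ (2n) = γ_n(f)` and `γ (2n + 1) = γ_n(g)`; the allowed indices form an interval `K` of
integers (finite, half-infinite or all of `ℤ`), so no index is skipped. -/
def ZerosInterlace (f g : ℂ → ℂ) : Prop :=
  ∃ (K : Set ℤ) (γ : ℤ → ℝ), K.OrdConnected ∧ StrictMonoOn γ K ∧
    zeroOrdinates f = γ '' {n | n ∈ K ∧ Even n} ∧
    zeroOrdinates g = γ '' {n | n ∈ K ∧ Odd n}

end

end DifferencedL

section

open Complex Filter Topology

namespace DifferencedL

/-! ### The Hermite–Biehler theorem for the critical line -/

/-! The pair A, B is the decomposition of E into its symmetric and antisymmetric parts under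
reflection in the critical line. It therefore suffices that E is zero-free on the line and strictly
dominates its reflection to the right of it: the Hermite–Biehler theorem (`hermite_biehler`) then
applies. Off the line the moduli of E and its reflection differ, so neither A nor B vanishes. On the
line A and B are the real part and minus the imaginary part of E, whose argument is strictly
increasing by a boundary lemma (`re_logDeriv_pos`), and this gives simplicity and interlacing.

By the functional equation, the domination for h > 0 reads |ξ(s - h)| < |ξ(s + h)| for Re s > 1/2
(`norm_xi_sub_lt`). No product over zeros is used. The quotient ξ(s - h)/ξ(s + h) has modulus 1 on
the critical line, is holomorphic to its right as long as s + h avoids the zeros of L, has at most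
exponential growth there, and tends to 0 along the positive real axis. Phragmén–Lindelöf bounds it
by 1, and the maximum principle makes the bound strict. The growth estimate
(`exists_norm_xi_quotient_le`) combines Mellin bounds for the numerator with lower bounds for Γ and,
by Borel–Carathéodory, for L in its zero-free half-plane: Re s > 1 unconditionally, Re s > 1/2 under
the Riemann hypothesis.

Negative h reduces to positive h, because the functional equation turns the reflection of E into a
function of the same family with -h and another θ. -/

/-- Strict Hopf boundary lemma for analytic functions: if `Re G` is less than `Re G(z₀)` to the
right of `z₀`, then `Re G'(z₀) < 0`. -/
theorem re_deriv_neg_of_re_lt {G : ℂ → ℂ} {z₀ : ℂ} (hG : AnalyticAt ℂ G z₀)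
    (hlt : ∀ z : ℂ, z₀.re < z.re → (G z).re < (G z₀).re) : (deriv G z₀).re < 0 := by
  set F : ℂ → ℂ := fun z => G z - G z₀ with hFdef
  have hF : AnalyticAt ℂ F z₀ := hG.sub analyticAt_const
  have hFneg : ∀ z : ℂ, z₀.re < z.re → (F z).re < 0 := fun z hz => by
    simpa [hFdef] using hlt z hz
  have hray : ∀ u : ℂ, Tendsto (fun r : ℝ => z₀ + r * u) (𝓝[>] 0) (𝓝 z₀) := fun u => by
    have : Continuous (fun r : ℝ => z₀ + r * u) := by fun_prop
    simpa using (this.tendsto 0).mono_left nhdsWithin_le_nhds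
  have hright : ∀ u : ℂ, 0 < u.re → ∀ r : ℝ, 0 < r → z₀.re < (z₀ + r * u).re :=
    fun u hu r hr => by simp; positivity
  have hord : analyticOrderAt F z₀ ≠ ⊤ := fun htop => by
    rw [analyticOrderAt_eq_top] at htop
    obtain ⟨r, hr, hr0⟩ := (((hray 1).eventually htop).and self_mem_nhdsWithin).exists
    have := hFneg _ (hright 1 (by simp) r hr0)
    rw [hr] at this
    exact this.false
  obtain ⟨g, hg, hg0, hFg⟩ := hF.analyticOrderAt_ne_top.mp hord
  set n := analyticOrderNatAt F z₀ with hn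
  have hn0 : n ≠ 0 := fun h0 => by
    have h := hFg.self_of_nhds
    rw [h0] at h
    simp [hFdef] at h
    exact hg0 h.symm
  have hdir : ∀ u : ℂ, 0 < u.re → (u ^ n * g z₀).re ≤ 0 := fun u hu => by
    have hlim : Tendsto (fun r : ℝ => (u ^ n * g (z₀ + r * u)).re) (𝓝[>] 0)
        (𝓝 (u ^ n * g z₀).re) :=
      (continuous_re.tendsto _).comp
        (tendsto_const_nhds.mul (hg.continuousAt.tendsto.comp (hray u)))
    refine le_of_tendsto hlim ?_
    filter_upwards [(hray u).eventually hFg, self_mem_nhdsWithin] with r hr hr0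
    have h1 := hFneg _ (hright u hu r hr0)
    rw [hr] at h1
    have h2 : (z₀ + r * u - z₀) ^ n • g (z₀ + r * u) = ((r ^ n : ℝ) : ℂ) * (u ^ n * g (z₀ + r * u)) := by
      push_cast
      simp only [smul_eq_mul]
      ring
    rw [h2, re_ofReal_mul] at h1
    have : 0 < r ^ n := pow_pos hr0 n
    by_contra! hc
    nlinarith
  set a := arg (g z₀) with ha
  -- The direction u = exp(-ia/(n+1)) balances the two constraints: u and u ^ n * g z₀ have opposite
  -- arguments ∓a/(n+1), so both would have positive real part if this angle were below π/2. Since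
  -- |a| ≤ π and n ≥ 1, only n = 1 and |a| = π survive.
  have hcos : ¬ |a / (n + 1)| < Real.pi / 2 := fun hlt => by
    have hc : 0 < Real.cos (a / (n + 1)) := Real.cos_pos_of_mem_Ioo (abs_lt.mp hlt)
    have h1 := hdir (exp ((-(a / (n + 1)) : ℝ) * I)) (by rw [exp_ofReal_mul_I_re, Real.cos_neg]; exact hc)
    have h2 : exp ((-(a / (n + 1)) : ℝ) * I) ^ n * g z₀
        = (‖g z₀‖ : ℝ) * exp ((a / (n + 1) : ℝ) * I) := by
      conv_lhs => rw [← norm_mul_exp_arg_mul_I (g z₀), ← ha]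
      rw [← exp_nat_mul, mul_left_comm, ← exp_add]
      congr 2
      push_cast
      have : (n : ℂ) + 1 ≠ 0 := by exact_mod_cast n.succ_ne_zero
      field_simp
      ring
    rw [h2, re_ofReal_mul, exp_ofReal_mul_I_re] at h1
    have := norm_pos_iff.mpr hg0
    nlinarith
  have hpi := abs_arg_le_pi (g z₀)
  rw [← ha] at hpi
  have hn1 : (0 : ℝ) < n + 1 := by positivity
  rw [abs_div, abs_of_pos hn1, div_lt_iff₀ hn1, not_lt] at hcos
  have hnle : n = 1 := by
    by_contra hne
    have : (2 : ℝ) ≤ n := by exact_mod_cast (by omega : 2 ≤ n)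
    nlinarith [Real.pi_pos]
  rw [hnle] at hcos hFg
  have hapi : a = Real.pi := by
    norm_num at hcos
    rcases le_abs.mp hcos with h | h
    · exact le_antisymm (arg_le_pi _) h
    · linarith [neg_pi_lt_arg (g z₀)]
  have hderiv : HasDerivAt F (g z₀) z₀ := by
    have h1 : HasDerivAt (fun z => (z - z₀) ^ 1 • g z) (g z₀) z₀ := by
      have := ((hasDerivAt_id z₀).sub_const z₀).fun_mul hg.differentiableAt.hasDerivAt
      simpa using this
    exact h1.congr_of_eventuallyEq hFg
  have : HasDerivAt G (g z₀) z₀ := by simpa [hFdef] using hderiv.add_const (G z₀)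
  rw [this.deriv]
  exact (arg_eq_pi_iff.mp hapi).1

/-- The reflection `s ↦ conj (f (1 - conj s))` of `f` in the critical line. -/
def reflect (f : ℂ → ℂ) (s : ℂ) : ℂ := conj (f (1 - conj s))

theorem hasDerivAt_reflect {f : ℂ → ℂ} (hf : Differentiable ℂ f) (s : ℂ) :
    HasDerivAt (reflect f) (-conj (deriv f (1 - conj s))) s := by
  have h : HasDerivAt (fun z => conj (f (conj z))) (conj (deriv f (1 - conj s))) (1 - s) := by
    have := (hf (1 - conj s)).hasDerivAt.conj_conj
    simpa [Function.comp_def] using this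
  have h2 := HasDerivAt.comp s h ((hasDerivAt_id s).const_sub 1)
  have h3 : reflect f = (fun z => conj (f (conj z))) ∘ fun z => 1 - z := by
    funext z
    simp [reflect]
  rw [h3]
  simpa using h2

theorem differentiable_reflect {f : ℂ → ℂ} (hf : Differentiable ℂ f) :
    Differentiable ℂ (reflect f) := fun s => (hasDerivAt_reflect hf s).differentiableAt

theorem one_sub_conj_of_re {s : ℂ} (hs : s.re = 1 / 2) : 1 - conj s = s := by
  apply Complex.ext <;> simp [hs]
  norm_num

variable {f : ℂ → ℂ}

/-- A function that dominates its reflection to the right of the critical line has increasing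
argument on the critical line. -/
theorem re_logDeriv_pos (hf : Differentiable ℂ f) (hne : ∀ s : ℂ, s.re = 1 / 2 → f s ≠ 0)
    (hlt : ∀ s : ℂ, 1 / 2 < s.re → ‖f (1 - conj s)‖ < ‖f s‖) {s : ℂ} (hs : s.re = 1 / 2) :
    0 < (deriv f s / f s).re := by
  have hfs := hne s hs
  have hrs : reflect f s = conj (f s) := by rw [reflect, one_sub_conj_of_re hs]
  have hrs0 : reflect f s ≠ 0 := by simpa [hrs] using hfs
  -- The constant has modulus 1 and normalises G s = 1, so |G| < 1 on the right gives Re G < Re G s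
  -- there. Since G' s = -2 Re(f'/f), the boundary lemma gives the claim.
  set G : ℂ → ℂ := fun z => reflect f z / f z * (f s / reflect f s) with hGdef
  have hnear : ∀ᶠ z in 𝓝 s, DifferentiableAt ℂ G z := by
    filter_upwards [hf.continuous.continuousAt.eventually_ne hfs] with z hz
    exact ((differentiable_reflect hf z).div (hf z) hz).mul_const _
  have hGa : AnalyticAt ℂ G s := by
    rw [analyticAt_iff_eventually_differentiableAt]
    exact hnear
  have hGs : G s = 1 := by simp only [hGdef]; field_simp
  have hnorm : ‖f s / reflect f s‖ = 1 := by
    rw [norm_div, hrs, RCLike.norm_conj, div_self (by simpa using hfs)]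
  have hG1 : ∀ z : ℂ, s.re < z.re → (G z).re < (G s).re := fun z hz => by
    rw [hGs, one_re]
    refine (re_le_norm _).trans_lt ?_
    have := hlt z (hs ▸ hz)
    simp only [hGdef]
    rw [norm_mul, hnorm, mul_one, norm_div, reflect, RCLike.norm_conj]
    rwa [div_lt_one ((norm_nonneg _).trans_lt this)]
  have hneg := re_deriv_neg_of_re_lt hGa hG1
  have hd : HasDerivAt G (-(conj (deriv f s / f s)) - deriv f s / f s) s := by
    have h := ((hasDerivAt_reflect hf s).div (hf s).hasDerivAt hfs).mul_const (f s / reflect f s)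
    rw [one_sub_conj_of_re hs] at h
    convert! h using 1
    have hc : conj (f s) ≠ 0 := by simpa using hfs
    rw [hrs, map_div₀]
    field_simp
  rw [hd.deriv] at hneg
  simp only [sub_re, neg_re, conj_re] at hneg
  linarith

theorem ordinate_re (t : ℝ) : (1 / 2 + t * I : ℂ).re = 1 / 2 := by simp

/-- The Hermite–Biehler theorem with respect to the critical line. -/
theorem hermite_biehler (hf : Differentiable ℂ f) (hne : ∀ s : ℂ, s.re = 1 / 2 → f s ≠ 0)
    (hlt : ∀ s : ℂ, 1 / 2 < s.re → ‖f (1 - conj s)‖ < ‖f s‖) {a b : ℂ → ℂ}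
    (ha : ∀ s, a s = 1 / 2 * (f s + reflect f s))
    (hb : ∀ s, b s = -(1 / (2 * I)) * (f s - reflect f s)) :
    (ZerosOnCriticalLine a ∧ ZerosOnCriticalLine b) ∧ (ZerosSimple a ∧ ZerosSimple b) ∧
      ZerosInterlace a b := by
  have hline : ∀ s, ‖f s‖ = ‖reflect f s‖ → s.re = 1 / 2 := fun s h => by
    rw [reflect, RCLike.norm_conj] at h
    rcases lt_trichotomy s.re (1 / 2) with hs | hs | hs
    · have := hlt (1 - conj s) (by simp; linarith)
      simp at this
      exact absurd h this.ne
    · exact hs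
    · exact absurd h (hlt s hs).ne'
  have hza : ∀ s, a s = 0 → f s = - reflect f s := fun s h => by
    rw [ha] at h
    simpa [add_eq_zero_iff_eq_neg] using h
  have hzb : ∀ s, b s = 0 → f s = reflect f s := fun s h => by
    rw [hb] at h
    simpa [sub_eq_zero] using h
  have hla : ZerosOnCriticalLine a := fun s h => hline s (by rw [hza s h, norm_neg])
  have hlb : ZerosOnCriticalLine b := fun s h => hline s (by rw [← hzb s h])
  have hdr := differentiable_reflect hf
  have hda : Differentiable ℂ a := by
    rw [funext ha]; exact (hf.add hdr).const_mul _
  have hdb : Differentiable ℂ b := by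
    rw [funext hb]; exact (hf.sub hdr).const_mul _
  -- At a zero of `a` or `b`, its derivative is a nonzero constant times 2 Re(f'/f) f, so positivity
  -- of Re(f'/f) gives simplicity.
  have hkey : ∀ s, s.re = 1 / 2 → deriv f s / f s + conj (deriv f s / f s) ≠ 0 := fun s hs h => by
    have := re_logDeriv_pos hf hne hlt hs
    have h' := congrArg re h
    simp only [add_re, conj_re, zero_re] at h'
    linarith
  have hdrs : ∀ s, s.re = 1 / 2 → deriv (reflect f) s = -conj (deriv f s / f s) * reflect f s :=
    fun s hs => by
      have hc : conj (f s) ≠ 0 := by simpa using hne s hs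
      rw [(hasDerivAt_reflect hf s).deriv, reflect, one_sub_conj_of_re hs, map_div₀]
      field_simp
  have hsa : ZerosSimple a := fun s h => by
    have hs := hla s h
    have hfs := hne s hs
    refine (hda.analyticAt s).analyticOrderAt_eq_one_of_zero_deriv_ne_zero h ?_
    have : deriv a s = 1 / 2 * (deriv f s + deriv (reflect f) s) := by
      rw [funext ha]
      exact (((hf s).hasDerivAt.add (hdr s).hasDerivAt).const_mul _).deriv
    rw [this, hdrs s hs, ← neg_eq_iff_eq_neg.mpr (hza s h)]
    have h2 : deriv f s + -conj (deriv f s / f s) * -f s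
        = (deriv f s / f s + conj (deriv f s / f s)) * f s := by
      field_simp
    rw [h2]
    exact mul_ne_zero (by norm_num) (mul_ne_zero (hkey s hs) hfs)
  have hsb : ZerosSimple b := fun s h => by
    have hs := hlb s h
    have hfs := hne s hs
    refine (hdb.analyticAt s).analyticOrderAt_eq_one_of_zero_deriv_ne_zero h ?_
    have : deriv b s = -(1 / (2 * I)) * (deriv f s - deriv (reflect f) s) := by
      rw [funext hb]
      exact (((hf s).hasDerivAt.sub (hdr s).hasDerivAt).const_mul _).deriv
    rw [this, hdrs s hs, ← hzb s h]
    have h2 : deriv f s - -conj (deriv f s / f s) * f s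
        = (deriv f s / f s + conj (deriv f s / f s)) * f s := by
      field_simp
      ring
    rw [h2]
    exact mul_ne_zero (by simp) (mul_ne_zero (hkey s hs) hfs)
  refine ⟨⟨hla, hlb⟩, ⟨hsa, hsb⟩, ?_⟩
  -- a continuous increasing argument `φ` on the critical line
  set p : ℝ → ℂ := fun t => f (1 / 2 + t * I) with hp
  set q : ℝ → ℂ := fun t => I * (deriv f (1 / 2 + t * I) / f (1 / 2 + t * I)) with hq
  have hp0 : ∀ t, p t ≠ 0 := fun t => hne _ (ordinate_re t)
  have hpd : ∀ t, HasDerivAt p (q t * p t) t := fun t => by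
    have h1 : HasDerivAt (fun t : ℝ => (1 / 2 + t * I : ℂ)) I t := by
      simpa using ((hasDerivAt_id t).ofReal_comp.mul_const I).const_add (1 / 2 : ℂ)
    have h2 := HasDerivAt.comp t (hf (1 / 2 + t * I)).hasDerivAt h1
    convert! h2 using 1
    simp only [hq, hp]
    rw [mul_assoc, div_mul_cancel₀ _ (hp0 t), mul_comm]
  have hqc : Continuous q := by
    have hl : Continuous (fun t : ℝ => (1 / 2 + t * I : ℂ)) := by fun_prop
    exact continuous_const.mul ((((hf.contDiff (n := 1)).continuous_deriv le_rfl).comp hl).div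
      (hf.continuous.comp hl) hp0)
  set Q : ℝ → ℂ := fun t => ∫ u in (0 : ℝ)..t, q u with hQ
  have hQd : ∀ t, HasDerivAt Q (q t) t := fun t => hqc.integral_hasStrictDerivAt 0 t |>.hasDerivAt
  -- Integrating the logarithmic derivative gives a global logarithm on the line, hence an argument
  -- with no branch jumps; its derivative is Im q = Re(f'/f) > 0.
  have hpQ : ∀ t, p t = p 0 * exp (Q t) := by
    have hc : ∀ t, HasDerivAt (fun t => p t * exp (-Q t)) 0 t := fun t => by
      have := (hpd t).mul (hQd t).neg.cexp
      convert! this using 1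
      ring
    intro t
    have := is_const_of_deriv_eq_zero (fun t => (hc t).differentiableAt)
      (fun t => (hc t).deriv) t 0
    have hQ0 : Q 0 = 0 := by simp [hQ]
    simp only [hQ0, neg_zero, exp_zero, mul_one] at this
    rw [← this, mul_assoc, ← exp_add, neg_add_cancel, exp_zero, mul_one]
  set φ : ℝ → ℝ := fun t => arg (p 0) + (Q t).im with hφ
  have hφd : ∀ t, HasDerivAt φ (q t).im t := fun t => by
    exact (imCLM.hasFDerivAt.comp_hasDerivAt t (hQd t)).const_add (arg (p 0))
  have hφpos : ∀ t, 0 < deriv φ t := fun t => by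
    rw [(hφd t).deriv]
    have := re_logDeriv_pos hf hne hlt (ordinate_re t)
    simpa [hq] using this
  have hmono : StrictMono φ := strictMono_of_deriv_pos hφpos
  have hφc : Continuous φ := continuous_iff_continuousAt.mpr fun t => (hφd t).continuousAt
  have hpφ : ∀ t, ∃ r : ℝ, 0 < r ∧ p t = r * exp (φ t * I) := fun t => by
    refine ⟨‖p 0‖ * Real.exp (Q t).re, mul_pos (norm_pos_iff.mpr (hp0 0)) (Real.exp_pos _), ?_⟩
    rw [hpQ t]
    conv_lhs => rw [← norm_mul_exp_arg_mul_I (p 0), ← re_add_im (Q t)]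
    simp only [hφ]
    push_cast
    rw [add_mul, exp_add, exp_add]
    ring
  have hva : ∀ t : ℝ, a (1 / 2 + t * I) = ((p t).re : ℂ) := fun t => by
    rw [ha, reflect, one_sub_conj_of_re (ordinate_re t), re_eq_add_conj]
    ring
  have hvb : ∀ t : ℝ, b (1 / 2 + t * I) = ((-(p t).im : ℝ) : ℂ) := fun t => by
    rw [hb, reflect, one_sub_conj_of_re (ordinate_re t), ofReal_neg, im_eq_sub_conj]
    ring
  have hA : ∀ t, t ∈ zeroOrdinates a ↔ Real.cos (φ t) = 0 := fun t => by
    obtain ⟨r, hr, h⟩ := hpφ t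
    rw [zeroOrdinates, Set.mem_ofPred_eq, hva, h, re_ofReal_mul, exp_ofReal_mul_I_re]
    rw [ofReal_eq_zero, mul_eq_zero, or_iff_right hr.ne']
  have hB : ∀ t, t ∈ zeroOrdinates b ↔ Real.sin (φ t) = 0 := fun t => by
    obtain ⟨r, hr, h⟩ := hpφ t
    rw [zeroOrdinates, Set.mem_ofPred_eq, hvb, h, im_ofReal_mul, exp_ofReal_mul_I_im]
    rw [ofReal_eq_zero, neg_eq_zero, mul_eq_zero, or_iff_right hr.ne']
  -- The shift by 1 sends even n to odd multiples of π/2 (zeros of cos, that is of `a`) and odd n to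
  -- multiples of π (zeros of sin, that is of `b`).
  set c : ℤ → ℝ := fun n => (n + 1) * (Real.pi / 2) with hc
  -- The allowed indices will be those whose value c n is attained by φ; no index is skipped because
  -- the range of φ is connected.
  have hcm : StrictMono c := fun m n h => by
    have : (m : ℝ) < n := by exact_mod_cast h
    simp only [hc]
    nlinarith [Real.pi_pos]
  set K : Set ℤ := {n | c n ∈ Set.range φ} with hK
  set γ : ℤ → ℝ := fun n => Function.invFun φ (c n) with hγ
  have hγφ : ∀ n ∈ K, φ (γ n) = c n := fun n hn => Function.invFun_eq hn
  have himage : ∀ (S : Set ℝ) (P : ℤ → Prop), (∀ t, t ∈ S ↔ ∃ n, P n ∧ φ t = c n) →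
      S = γ '' {n | n ∈ K ∧ P n} := fun S P h => by
    ext t
    rw [h]
    constructor
    · rintro ⟨n, hn, ht⟩
      have hnK : n ∈ K := ⟨t, ht⟩
      exact ⟨n, ⟨hnK, hn⟩, hmono.injective ((hγφ n hnK).trans ht.symm)⟩
    · rintro ⟨n, ⟨hnK, hn⟩, rfl⟩
      exact ⟨n, hn, hγφ n hnK⟩
  refine ⟨K, γ, ?_, ?_, himage _ _ fun t => ?_, himage _ _ fun t => ?_⟩
  · exact (isPreconnected_range hφc).ordConnected.preimage_mono hcm.monotone
  · intro m hm n hn hmn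
    rw [← hmono.lt_iff_lt, hγφ m hm, hγφ n hn]
    exact hcm hmn
  · rw [hA, Real.cos_eq_zero_iff]
    constructor
    · rintro ⟨k, hk⟩
      exact ⟨2 * k, even_two_mul k, by rw [hk]; simp only [hc]; push_cast; ring⟩
    · rintro ⟨n, ⟨k, rfl⟩, hk⟩
      exact ⟨k, by rw [hk]; simp only [hc]; push_cast; ring⟩
  · rw [hB, Real.sin_eq_zero_iff]
    constructor
    · rintro ⟨k, hk⟩
      exact ⟨2 * (k - 1) + 1, odd_two_mul_add_one _, by rw [← hk]; simp only [hc]; push_cast; ring⟩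
    · rintro ⟨n, ⟨k, rfl⟩, hk⟩
      exact ⟨k + 1, by rw [hk]; simp only [hc]; push_cast; ring⟩

/-! ### Gamma and Mellin estimates -/

-- On the strip the integrand is dominated independently of s, since t^(Re s - 1) ≤ t^(a - 1) for t
-- ≤ 1 and ≤ t^(b - 1) for t ≥ 1.
open MeasureTheory in
theorem exists_norm_mellin_le {f : ℝ → ℂ} {a b : ℝ} (ha : MellinConvergent f a)
    (hb : MellinConvergent f b) :
    ∃ C : ℝ, ∀ s : ℂ, a ≤ s.re → s.re ≤ b → ‖mellin f s‖ ≤ C := by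
  refine ⟨∫ t in Set.Ioi (0 : ℝ), (‖(t : ℂ) ^ ((a : ℂ) - 1) • f t‖ + ‖(t : ℂ) ^ ((b : ℂ) - 1) • f t‖),
    fun s has hsb => norm_integral_le_of_norm_le (ha.norm.add hb.norm) ?_⟩
  filter_upwards [ae_restrict_mem measurableSet_Ioi] with t ht
  have ht : (0 : ℝ) < t := ht
  simp only [norm_smul, norm_cpow_eq_rpow_re_of_pos ht, sub_re, ofReal_re, one_re]
  rw [← add_mul]
  gcongr
  rcases le_total t 1 with h1 | h1
  · have := Real.rpow_le_rpow_of_exponent_ge ht h1 (sub_le_sub_right has 1)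
    linarith [Real.rpow_pos_of_pos ht (b - 1)]
  · have := Real.rpow_le_rpow_of_exponent_le h1 (sub_le_sub_right hsb 1)
    linarith [Real.rpow_pos_of_pos ht (a - 1)]

open intervalIntegral in
theorem norm_betaIntegral_le (u v : ℂ) :
    ‖betaIntegral u v‖ ≤ ‖betaIntegral (u.re : ℂ) (v.re : ℂ)‖ := by
  have hpt : ∀ (u v : ℂ) (x : ℝ), 0 < x → x < 1 →
      ‖(x : ℂ) ^ (u - 1) * (1 - (x : ℂ)) ^ (v - 1)‖ = x ^ (u.re - 1) * (1 - x) ^ (v.re - 1) := by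
    intro u v x h0 h1
    have : (1 - (x : ℂ)) = ((1 - x : ℝ) : ℂ) := by push_cast; rfl
    rw [norm_mul, this, norm_cpow_eq_rpow_re_of_pos h0,
      norm_cpow_eq_rpow_re_of_pos (sub_pos.mpr h1)]
    simp
  have hreal : betaIntegral (u.re : ℂ) (v.re : ℂ)
      = ((∫ x in (0 : ℝ)..1, x ^ (u.re - 1) * (1 - x) ^ (v.re - 1) : ℝ) : ℂ) := by
    rw [betaIntegral, ← intervalIntegral.integral_ofReal]
    refine integral_congr fun x hx => ?_
    rw [Set.uIcc_of_le zero_le_one] at hx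
    simp only [ofReal_mul]
    rw [ofReal_cpow hx.1, ofReal_cpow (sub_nonneg.mpr hx.2)]
    push_cast
    rfl
  have hnn : 0 ≤ ∫ x in (0 : ℝ)..1, x ^ (u.re - 1) * (1 - x) ^ (v.re - 1) :=
    integral_nonneg zero_le_one fun x hx =>
      mul_nonneg (Real.rpow_nonneg hx.1 _) (Real.rpow_nonneg (sub_nonneg.mpr hx.2) _)
  rw [hreal, norm_real, Real.norm_of_nonneg hnn, betaIntegral]
  refine (norm_integral_le_integral_norm zero_le_one).trans_eq ?_
  rw [integral_of_le zero_le_one, integral_of_le zero_le_one,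
    MeasureTheory.integral_Ioc_eq_integral_Ioo, MeasureTheory.integral_Ioc_eq_integral_Ioo]
  exact MeasureTheory.setIntegral_congr_fun measurableSet_Ioo fun x hx => hpt u v x hx.1 hx.2

/-- The quotient Γ(a)/Γ(a + d) is the beta integral B(a, d) divided by Γ(d), and the modulus of the
beta integral is largest at real arguments. This makes quotient bounds uniform in Im a. -/
theorem norm_Gamma_mul_le {a : ℂ} (ha : 0 < a.re) {d : ℝ} (hd : 0 < d) :
    ‖Gamma a‖ * Real.Gamma (a.re + d) ≤ Real.Gamma a.re * ‖Gamma (a + d)‖ := by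
  have hd' : 0 < (d : ℂ).re := hd
  have h1 := congrArg norm (Gamma_mul_Gamma_eq_betaIntegral ha hd')
  have h2 := congrArg norm (Gamma_mul_Gamma_eq_betaIntegral (s := (a.re : ℂ)) (by simpa using ha) hd')
  have hβ := norm_betaIntegral_le a d
  rw [ofReal_re] at hβ
  have e1 : ‖Gamma (a.re : ℂ)‖ = Real.Gamma a.re := by
    rw [Gamma_ofReal, norm_real, Real.norm_of_nonneg (Real.Gamma_pos_of_pos ha).le]
  have e2 : ‖Gamma (a.re + d : ℂ)‖ = Real.Gamma (a.re + d) := by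
    rw [← ofReal_add, Gamma_ofReal, norm_real,
      Real.norm_of_nonneg (Real.Gamma_pos_of_pos (by positivity)).le]
  have e3 : ‖Gamma (d : ℂ)‖ = Real.Gamma d := by
    rw [Gamma_ofReal, norm_real, Real.norm_of_nonneg (Real.Gamma_pos_of_pos hd).le]
  rw [norm_mul, norm_mul, e3] at h1 h2
  rw [e1, e2] at h2
  have p3 := Real.Gamma_pos_of_pos hd
  have p2 : 0 < Real.Gamma (a.re + d) := Real.Gamma_pos_of_pos (by positivity)
  refine le_of_mul_le_mul_right ?_ p3
  calc ‖Gamma a‖ * Real.Gamma (a.re + d) * Real.Gamma d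
      = Real.Gamma (a.re + d) * ‖Gamma (a + d)‖ * ‖betaIntegral a d‖ := by
        rw [mul_right_comm, h1]; ring
    _ ≤ Real.Gamma (a.re + d) * ‖Gamma (a + d)‖ * ‖betaIntegral a.re d‖ := by gcongr
    _ = Real.Gamma a.re * ‖Gamma (a + d)‖ * Real.Gamma d := by
        rw [mul_right_comm, ← h2]; ring

/-- On this line the reflection formula becomes |Γ(1/2 + iy)|² = π / cosh(πy); a crude consequence
is enough. -/
theorem one_le_norm_Gamma_half_add_mul (y : ℝ) :
    1 ≤ ‖Gamma (1 / 2 + y * I)‖ * Real.exp (Real.pi * |y|) := by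
  set w : ℂ := 1 / 2 + y * I with hw
  have hconj : 1 - w = conj w := by
    apply Complex.ext <;> simp [hw]
    norm_num
  have hre : 0 < w.re := by simp [hw]
  have hsin : ‖sin (Real.pi * w)‖ ≤ Real.exp (Real.pi * |y|) := by
    have h1 : (Real.pi * w) = Real.pi / 2 - (-(Real.pi * y * I)) := by rw [hw]; ring
    rw [h1, sin_pi_div_two_sub, cos_neg, ← ofReal_mul, cos_mul_I, ← ofReal_cosh, norm_real,
      Real.norm_of_nonneg (Real.cosh_pos _).le, Real.cosh_eq]
    have a1 : Real.exp (Real.pi * y) ≤ Real.exp (Real.pi * |y|) := by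
      gcongr; exact le_abs_self y
    have a2 : Real.exp (-(Real.pi * y)) ≤ Real.exp (Real.pi * |y|) := by
      rw [← mul_neg]; gcongr; exact neg_le_abs y
    linarith
  have h := Gamma_mul_Gamma_one_sub w
  rw [hconj, Gamma_conj] at h
  have hΓ : Gamma w ≠ 0 := Gamma_ne_zero_of_re_pos hre
  have hs0 : sin (Real.pi * w) ≠ 0 := fun h0 => by
    rw [h0, div_zero] at h
    simp [hΓ] at h
  rw [eq_div_iff hs0] at h
  have h2 := congrArg norm h
  rw [norm_mul, norm_mul, RCLike.norm_conj, norm_real, Real.norm_of_nonneg Real.pi_pos.le] at h2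
  set g := ‖Gamma w‖
  have hg : 0 ≤ g := norm_nonneg _
  have he : 1 ≤ Real.exp (Real.pi * |y|) := Real.one_le_exp (by positivity)
  have : Real.pi ≤ g * g * Real.exp (Real.pi * |y|) := by
    have := mul_le_mul_of_nonneg_left hsin (mul_nonneg hg hg)
    linarith
  have hpi := Real.pi_gt_three
  set e := Real.exp (Real.pi * |y|)
  by_contra! hlt
  nlinarith [mul_nonneg hg (by linarith : 0 ≤ e)]

theorem exists_norm_Gamma_inv_le (b : ℝ) :
    ∃ C : ℝ, ∀ a : ℂ, 0 < a.re → a.re ≤ b → ‖(Gamma a)⁻¹‖ ≤ C * Real.exp (5 * |a.im|) := by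
  have hcont : ContinuousOn Real.Gamma (Set.Icc 1 (b + 1)) := fun x hx =>
    (Real.differentiableAt_Gamma fun m => by
      have : 0 < x := by linarith [hx.1]
      have hm : (0 : ℝ) ≤ m := m.cast_nonneg
      linarith).continuousAt.continuousWithinAt
  obtain ⟨m, hm, hmΓ⟩ : ∃ m : ℝ, 0 < m ∧ ∀ x ∈ Set.Icc (1 : ℝ) (b + 1), m ≤ Real.Gamma x := by
    rcases (Set.Icc (1 : ℝ) (b + 1)).eq_empty_or_nonempty with he | hne
    · exact ⟨1, one_pos, by simp [he]⟩
    · obtain ⟨x, hx, hmin⟩ := isCompact_Icc.exists_isMinOn hne hcont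
      exact ⟨_, Real.Gamma_pos_of_pos (by linarith [hx.1]), fun y hy => hmin hy⟩
  -- Γ is compared on the line Re = 1/2 and at a + 1, a shift by the positive real number Re a +
  -- 1/2; passing from a + 1 back to a costs the factor |a|. Going through a + 1 keeps real parts in
  -- [1, b + 1], away from the pole at 0. The rate 5 covers π < 4 plus 1 for |a|.
  refine ⟨(|b| + 1) * (Real.Gamma (1 / 2) / m), fun a ha hab => ?_⟩
  have ha0 : a ≠ 0 := fun h => by simp [h] at ha
  set w : ℂ := 1 / 2 + a.im * I with hw
  have hwre : w.re = 1 / 2 := by simp [hw]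
  have h1 := norm_Gamma_mul_le (a := w) (by rw [hwre]; norm_num) (d := a.re + 1 / 2) (by positivity)
  have hsum : w + ((a.re + 1 / 2 : ℝ) : ℂ) = a + 1 := by
    apply Complex.ext <;> simp [hw]
    ring
  rw [hsum, hwre, Gamma_add_one a ha0, norm_mul] at h1
  have h2 := one_le_norm_Gamma_half_add_mul a.im
  rw [← hw] at h2
  have h3 : m ≤ Real.Gamma (1 / 2 + (a.re + 1 / 2)) := hmΓ _ ⟨by linarith, by linarith⟩
  have hΓ : 0 < ‖Gamma a‖ := norm_pos_iff.mpr (Gamma_ne_zero_of_re_pos ha)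
  have hΓh : 0 < Real.Gamma (1 / 2) := Real.Gamma_pos_of_pos (by norm_num)
  have hna : ‖a‖ ≤ (|b| + 1) * Real.exp |a.im| := by
    have e1 := norm_le_abs_re_add_abs_im a
    have e2 : |a.re| ≤ |b| := by rw [abs_of_pos ha]; exact hab.trans (le_abs_self b)
    have e3 := Real.add_one_le_exp |a.im|
    have e4 := abs_nonneg a.im
    have e5 := abs_nonneg b
    nlinarith
  rw [norm_inv, inv_le_iff_one_le_mul₀ hΓ]
  have hexp : Real.exp |a.im| * Real.exp (Real.pi * |a.im|) ≤ Real.exp (5 * |a.im|) := by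
    rw [← Real.exp_add]
    gcongr
    nlinarith [Real.pi_lt_four, abs_nonneg a.im]
  have hkey : m ≤ (|b| + 1) * Real.Gamma (1 / 2) * Real.exp (5 * |a.im|) * ‖Gamma a‖ := by
    calc m ≤ m * (‖Gamma w‖ * Real.exp (Real.pi * |a.im|)) := le_mul_of_one_le_right hm.le h2
      _ = (‖Gamma w‖ * m) * Real.exp (Real.pi * |a.im|) := by ring
      _ ≤ (‖Gamma w‖ * Real.Gamma (1 / 2 + (a.re + 1 / 2))) * Real.exp (Real.pi * |a.im|) := by
        gcongr
      _ ≤ (Real.Gamma (1 / 2) * (‖a‖ * ‖Gamma a‖)) * Real.exp (Real.pi * |a.im|) := by gcongr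
      _ ≤ (Real.Gamma (1 / 2) * ((|b| + 1) * Real.exp |a.im| * ‖Gamma a‖)) *
          Real.exp (Real.pi * |a.im|) := by gcongr
      _ = (|b| + 1) * Real.Gamma (1 / 2) * (Real.exp |a.im| * Real.exp (Real.pi * |a.im|)) *
          ‖Gamma a‖ := by ring
      _ ≤ _ := by gcongr
  have : (|b| + 1) * (Real.Gamma (1 / 2) / m) * Real.exp (5 * |a.im|) * ‖Gamma a‖
      = ((|b| + 1) * Real.Gamma (1 / 2) * Real.exp (5 * |a.im|) * ‖Gamma a‖) / m := by ring
  rw [this, le_div_iff₀ hm, one_mul]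
  exact hkey

theorem tendsto_Gamma_div_Gamma_add {h : ℝ} (hh : 0 < h) :
    Tendsto (fun x : ℝ => Real.Gamma x / Real.Gamma (x + h)) atTop (𝓝 0) := by
  set c : ℝ := min h (1 / 2) with hc
  have hc0 : 0 < c := lt_min hh (by norm_num)
  have hc1 : c < 1 := (min_le_right _ _).trans_lt (by norm_num)
  have hch : c ≤ h := min_le_left _ _
  have hlim : Tendsto (fun x : ℝ => 2 ^ (1 - c) * x ^ (-c)) atTop (𝓝 0) := by
    simpa using (tendsto_rpow_neg_atTop hc0).const_mul ((2 : ℝ) ^ (1 - c))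
  refine squeeze_zero' ?_ ?_ hlim
  · filter_upwards [eventually_gt_atTop 0] with x hx
    exact div_nonneg (Real.Gamma_pos_of_pos hx).le (Real.Gamma_pos_of_pos (by positivity)).le
  · filter_upwards [eventually_ge_atTop 2] with x hx
    have hx0 : 0 < x := by linarith
    have hxc : 0 < x + c := by linarith
    have hmono : Real.Gamma (x + c) ≤ Real.Gamma (x + h) :=
      Real.Gamma_strictMonoOn_Ici.monotoneOn (Set.mem_Ici.mpr (by linarith))
        (Set.mem_Ici.mpr (by linarith)) (by linarith)
    have hp := Real.Gamma_pos_of_pos hxc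
    -- Log-convexity at x + 1, which lies between x + c and x + c + 1 because 0 < c < 1; it yields
    -- Γ(x + 1) ≤ (x + c)^(1 - c) Γ(x + c).
    have hlog := Real.Gamma_mul_add_mul_le_rpow_Gamma_mul_rpow_Gamma hxc
      (by linarith : 0 < x + c + 1) hc0 (sub_pos.mpr hc1) (by ring)
    have e1 : c * (x + c) + (1 - c) * (x + c + 1) = x + 1 := by ring
    rw [e1, Real.Gamma_add_one hx0.ne', Real.Gamma_add_one hxc.ne',
      Real.mul_rpow hxc.le hp.le, mul_left_comm, ← Real.rpow_add hp, add_sub_cancel,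
      Real.rpow_one] at hlog
    have hpow : (x + c) ^ (1 - c) ≤ 2 ^ (1 - c) * x ^ (1 - c) := by
      rw [← Real.mul_rpow (by norm_num) hx0.le]
      exact Real.rpow_le_rpow hxc.le (by linarith) (by linarith)
    rw [div_le_iff₀ (hp.trans_le hmono)]
    refine le_of_mul_le_mul_left ?_ hx0
    calc x * Real.Gamma x ≤ (x + c) ^ (1 - c) * Real.Gamma (x + c) := hlog
      _ ≤ (2 ^ (1 - c) * x ^ (1 - c)) * Real.Gamma (x + h) := by gcongr
      _ = x * (2 ^ (1 - c) * x ^ (-c) * Real.Gamma (x + h)) := by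
        rw [sub_eq_neg_add 1 c, Real.rpow_add hx0 (-c) 1, Real.rpow_one]
        ring

/-- A lower bound for zero-free functions, by the Borel–Carathéodory theorem. -/
theorem norm_inv_le_of_ne_zero_on_ball {g : ℂ → ℂ} {c : ℂ} {R r M D : ℝ} (hr : 0 ≤ r) (hrR : r < R)
    (hM : 0 < M) (hg : DifferentiableOn ℂ g (Metric.ball c R))
    (h0 : ∀ z ∈ Metric.ball c R, g z ≠ 0) (hle : ∀ z ∈ Metric.ball c R, ‖g z‖ ≤ Real.exp M)
    (hD : |Real.log ‖g c‖| ≤ D) {z : ℂ} (hz : ‖z - c‖ ≤ r) :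
    ‖(g z)⁻¹‖ ≤ Real.exp (2 * M * r / (R - r) + (D + Real.pi) * (R + r) / (R - r)) := by
  have hR : 0 < R := hr.trans_lt hrR
  have hcR : c ∈ Metric.ball c R := Metric.mem_ball_self hR
  have hq : DifferentiableOn ℂ (fun z => deriv g z / g z) (Metric.ball c R) :=
    (hg.deriv Metric.isOpen_ball).div hg h0
  -- A primitive of g'/g is a holomorphic logarithm l of g. Borel–Carathéodory turns the upper bound
  -- on Re l = log |g| into a bound on |l|, hence on -Re l = log |1/g|.
  obtain ⟨l, hlc, hl⟩ := hq.isExactOn_ball.with_val_at c (log (g c))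
  have hexp : ∀ z ∈ Metric.ball c R, g z = exp (l z) := by
    have hd : ∀ z ∈ Metric.ball c R, HasDerivAt (fun z => g z * exp (-l z)) 0 z := fun z hz => by
      have hgz : DifferentiableAt ℂ g z := hg.differentiableAt (Metric.isOpen_ball.mem_nhds hz)
      have := hgz.hasDerivAt.fun_mul (hl z hz).fun_neg.cexp
      convert! this using 1
      have := h0 z hz
      field_simp
      ring
    intro z hz
    have hconst := (convex_ball c R).is_const_of_fderivWithin_eq_zero (𝕜 := ℂ)
      (fun z hz => (hd z hz).differentiableAt.differentiableWithinAt)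
      (fun z hz => by
        rw [fderivWithin_of_isOpen Metric.isOpen_ball hz]
        ext
        simp [(hd z hz).deriv]) hz hcR
    simp only [hlc, exp_neg, exp_log (h0 c hcR), mul_inv_cancel₀ (h0 c hcR)] at hconst
    rwa [mul_inv_eq_one₀ (exp_ne_zero _)] at hconst
  have hre : ∀ z ∈ Metric.ball c R, (l z).re ≤ M := fun z hz => by
    have := hle z hz
    rw [hexp z hz, norm_exp] at this
    exact Real.exp_le_exp.mp this
  have hshift : Set.MapsTo (fun w : ℂ => c + w) (Metric.ball 0 R) (Metric.ball c R) := fun w hw => by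
    simpa using hw
  have hzr : z - c ∈ Metric.ball (0 : ℂ) R := by simpa using hz.trans_lt hrR
  have hBC := borelCaratheodory (f := fun w => l (c + w)) (z := z - c) hM
    (fun w hw => ((hl _ (hshift hw)).differentiableAt.comp w
      (by fun_prop)).differentiableWithinAt)
    (fun w hw => hre _ (hshift hw)) hR hzr
  simp only [add_sub_cancel, add_zero, hlc] at hBC
  have hzR : z ∈ Metric.ball c R := by simpa [dist_eq] using hz.trans_lt hrR
  have hlog : ‖log (g c)‖ ≤ D + Real.pi := by
    have := norm_le_abs_re_add_abs_im (log (g c))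
    rw [log_re, log_im] at this
    linarith [abs_arg_le_pi (g c)]
  rw [hexp z hzR, ← exp_neg, norm_exp, neg_re]
  refine Real.exp_le_exp.mpr (((neg_le_abs _).trans (abs_re_le_norm _)).trans (hBC.trans ?_))
  have hRr : 0 < R - r := sub_pos.mpr hrR
  have hD0 : 0 ≤ D := (abs_nonneg _).trans hD
  have := Real.pi_pos
  gcongr

variable {N : ℕ} [NeZero N] {χ : DirichletCharacter ℂ N}

/-! ### The completed `L`-function -/

/-- The completed L-function is a finite combination of completed Hurwitz zeta functions. Their
polar terms cancel because χ(0) = 0 and the values of χ sum to 0, and what remains are Mellin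
transforms converging for every s. -/
theorem exists_norm_completedLFunction_le (hχ : χ ≠ 1) (a b : ℝ) :
    ∃ C : ℝ, ∀ s : ℂ, a ≤ s.re → s.re ≤ b → ‖χ.completedLFunction s‖ ≤ C := by
  have hN1 : N ≠ 1 := fun h => hχ (DirichletCharacter.level_one' χ h)
  have heven : ∀ x : UnitAddCircle, ∃ C : ℝ, ∀ s : ℂ, a ≤ s.re → s.re ≤ b →
      ‖HurwitzZeta.completedHurwitzZetaEven₀ x s‖ ≤ C := fun x => by
    have hm := fun s => ((HurwitzZeta.hurwitzEvenFEPair x).isStrongFEPair_toStrongFEPair.hasMellin s).1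
    obtain ⟨C, hC⟩ := exists_norm_mellin_le (hm (a / 2 : ℝ)) (hm (b / 2 : ℝ))
    refine ⟨C / 2, fun s hsa hsb => ?_⟩
    rw [HurwitzZeta.completedHurwitzZetaEven₀, norm_div, norm_ofNat]
    gcongr
    exact hC (s / 2) (by simp; linarith) (by simp; linarith)
  have hodd : ∀ x : UnitAddCircle, ∃ C : ℝ, ∀ s : ℂ, a ≤ s.re → s.re ≤ b →
      ‖HurwitzZeta.completedHurwitzZetaOdd x s‖ ≤ C := fun x => by
    have hP := HurwitzZeta.isStrong_hurwitzOddFEPair x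
    have hm := fun s => (hP.hasMellin s).1
    obtain ⟨C, hC⟩ := exists_norm_mellin_le (hm ((a + 1) / 2 : ℝ)) (hm ((b + 1) / 2 : ℝ))
    refine ⟨C / 2, fun s hsa hsb => ?_⟩
    rw [HurwitzZeta.completedHurwitzZetaOdd, norm_div, norm_ofNat, hP.Λ_eq]
    gcongr
    exact hC ((s + 1) / 2) (by simp; linarith) (by simp; linarith)
  choose Ce hCe using heven
  choose Co hCo using hodd
  have hN : (1 : ℝ) ≤ N := by exact_mod_cast NeZero.one_le
  refine ⟨(N : ℝ) ^ (-a) * ∑ j : ZMod N, ‖χ j‖ * Ce (ZMod.toAddCircle j) +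
    (N : ℝ) ^ (-a) * ∑ j : ZMod N, ‖χ j‖ * Co (ZMod.toAddCircle j), fun s hsa hsb => ?_⟩
  have hpow : ‖(N : ℂ) ^ (-s)‖ ≤ (N : ℝ) ^ (-a) := by
    rw [norm_natCast_cpow_of_pos (NeZero.pos N)]
    exact Real.rpow_le_rpow_of_exponent_le hN (by simpa using hsa)
  have hχ0 : χ 0 = 0 := χ.map_zero' hN1
  rw [DirichletCharacter.completedLFunction, ZMod.completedLFunction_eq, hχ0,
    MulChar.sum_eq_zero_of_ne_one hχ, mul_zero, zero_div, zero_div, sub_zero, sub_zero,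
    ZMod.completedLFunction₀]
  refine (norm_add_le _ _).trans ?_
  rw [norm_mul, norm_mul]
  gcongr
  · refine norm_sum_le_of_le _ fun j _ => ?_
    rw [norm_mul]
    gcongr
    exact hCe _ s hsa hsb
  · refine norm_sum_le_of_le _ fun j _ => ?_
    rw [norm_mul]
    gcongr
    exact hCo _ s hsa hsb

theorem half_add_parity_re {N : ℕ} {χ : DirichletCharacter ℂ N} (s : ℂ) : ((s + parity χ) / 2).re = (s.re + parity χ) / 2 := by simp

theorem exists_norm_xi_le (hχ : χ ≠ 1) (a b : ℝ) :
    ∃ C : ℝ, 0 ≤ C ∧ ∀ s : ℂ, a ≤ s.re → s.re ≤ b → ‖xi χ s‖ ≤ C := by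
  obtain ⟨C, hC⟩ := exists_norm_completedLFunction_le hχ a b
  have hN : (1 : ℝ) ≤ N := by exact_mod_cast NeZero.one_le
  refine ⟨(N : ℝ) ^ ((b + parity χ) / 2) * |C|, by positivity, fun s hsa hsb => ?_⟩
  rw [xi, norm_mul, norm_natCast_cpow_of_pos (NeZero.pos N)]
  gcongr
  · rw [half_add_parity_re]
    linarith
  · exact (hC s hsa hsb).trans (le_abs_self C)

theorem norm_xi (hχ : χ ≠ 1) {s : ℂ} (hs : 0 < s.re) :
    ‖xi χ s‖ = (Real.pi / N) ^ (-(s.re + parity χ) / 2) * ‖Gamma ((s + parity χ) / 2)‖ *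
      ‖χ.LFunction s‖ := by
  have hpos : 0 < Real.pi / N := div_pos Real.pi_pos (Nat.cast_pos.mpr (NeZero.pos N))
  rw [xi_eq hχ, norm_mul, norm_mul, norm_cpow_eq_rpow_re_of_pos hpos]
  · simp
  · intro m hm
    have h := congrArg re hm
    rw [half_add_parity_re, neg_re, natCast_re] at h
    have h1 : (0 : ℝ) ≤ parity χ := Nat.cast_nonneg _
    have h2 : (0 : ℝ) ≤ m := Nat.cast_nonneg _
    linarith

theorem xi_ne_zero (hχ : χ ≠ 1) {s : ℂ} (hs : 0 < s.re) (hL : χ.LFunction s ≠ 0) :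
    xi χ s ≠ 0 := by
  have hpos : 0 < Real.pi / N := div_pos Real.pi_pos (Nat.cast_pos.mpr (NeZero.pos N))
  rw [← norm_pos_iff, norm_xi hχ hs]
  have h1 : (0 : ℝ) ≤ parity χ := Nat.cast_nonneg _
  have hΓ : Gamma ((s + parity χ) / 2) ≠ 0 :=
    Gamma_ne_zero_of_re_pos (by rw [half_add_parity_re]; linarith)
  positivity

/-! ### Bounds for `L(s, χ)` and its inverse -/

/-- Both L and 1/L are Dirichlet series with coefficients bounded by 1 (χ and χμ), so ζ(2) dominates
them. -/
theorem exists_norm_LFunction_le_of_two_le_re (χ : DirichletCharacter ℂ N) :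
    ∃ Z : ℝ, 0 < Z ∧ ∀ s : ℂ, 2 ≤ s.re →
      ‖χ.LFunction s‖ ≤ Z ∧ ‖(χ.LFunction s)⁻¹‖ ≤ Z := by
  have hsum : Summable fun n : ℕ => 1 / (n : ℝ) ^ (2 : ℝ) :=
    Real.summable_one_div_nat_rpow.mpr (by norm_num)
  have hbound : ∀ (f : ℕ → ℂ), (∀ n, ‖f n‖ ≤ 1) → ∀ s : ℂ, 2 ≤ s.re →
      ‖LSeries f s‖ ≤ ∑' n : ℕ, 1 / (n : ℝ) ^ (2 : ℝ) := fun f hf s hs => by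
    refine tsum_of_norm_bounded hsum.hasSum fun n => ?_
    rw [LSeries.norm_term_eq]
    split_ifs with hn
    · positivity
    · have hn1 : (1 : ℝ) ≤ n := by exact_mod_cast Nat.one_le_iff_ne_zero.mpr hn
      gcongr
      exact hf n
  refine ⟨∑' n : ℕ, 1 / (n : ℝ) ^ (2 : ℝ),
    hsum.tsum_pos (fun n => by positivity) 1 (by norm_num), fun s hs => ?_⟩
  have hs1 : 1 < s.re := by linarith
  rw [χ.LFunction_eq_LSeries hs1]
  refine ⟨hbound _ (fun n => χ.norm_le_one _) s hs, ?_⟩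
  rw [inv_eq_of_mul_eq_one_right (DirichletCharacter.LSeries.mul_mu_eq_one χ hs1)]
  refine hbound _ (fun n => ?_) s hs
  simp only [Pi.mul_apply, norm_mul]
  refine mul_le_one₀ (χ.norm_le_one _) (norm_nonneg _) ?_
  rw [norm_intCast]
  exact_mod_cast ArithmeticFunction.abs_moebius_le_one

/-- L is ξ, bounded on vertical strips, divided by the Gamma factor. -/
theorem exists_norm_LFunction_le (hχ : χ ≠ 1) (b : ℝ) :
    ∃ C : ℝ, 0 ≤ C ∧ ∀ s : ℂ, 0 < s.re → s.re ≤ b →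
      ‖χ.LFunction s‖ ≤ C * Real.exp (5 * |s.im|) := by
  obtain ⟨C₁, hC₁, h₁⟩ := exists_norm_xi_le hχ 0 b
  obtain ⟨C₂, h₂⟩ := exists_norm_Gamma_inv_le ((b + parity χ) / 2)
  have hpos : 0 < Real.pi / N := div_pos Real.pi_pos (Nat.cast_pos.mpr (NeZero.pos N))
  have hk : (0 : ℝ) ≤ parity χ := Nat.cast_nonneg _
  obtain ⟨C₃, hC₃, h₃⟩ : ∃ C₃ : ℝ, 0 ≤ C₃ ∧ ∀ x : ℝ, 0 ≤ x → x ≤ b →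
      (Real.pi / N) ^ ((x + parity χ) / 2) ≤ C₃ := by
    refine ⟨max 1 (Real.pi / N) ^ ((b + parity χ) / 2), by positivity, fun x h0 hx => ?_⟩
    exact (Real.rpow_le_rpow hpos.le (le_max_right 1 _) (by linarith)).trans
      (Real.rpow_le_rpow_of_exponent_le (le_max_left _ _) (by linarith))
  refine ⟨C₁ * C₃ * |C₂|, by positivity, fun s hs hsb => ?_⟩
  have hre := half_add_parity_re (χ := χ) s
  have hΓ0 : Gamma ((s + parity χ) / 2) ≠ 0 :=
    Gamma_ne_zero_of_re_pos (by rw [hre]; linarith)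
  have hL : ‖χ.LFunction s‖ = ‖xi χ s‖ * (Real.pi / N) ^ ((s.re + parity χ) / 2) *
      ‖(Gamma ((s + parity χ) / 2))⁻¹‖ := by
    have := norm_pos_iff.mpr hΓ0
    rw [norm_xi hχ hs, norm_inv, neg_div, Real.rpow_neg hpos.le]
    field_simp
  have hΓ : ‖(Gamma ((s + parity χ) / 2))⁻¹‖ ≤ |C₂| * Real.exp (5 * |s.im|) := by
    refine (h₂ _ (by rw [hre]; linarith) (by rw [hre]; linarith)).trans ?_
    have him : ((s + parity χ) / 2).im = s.im / 2 := by simp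
    rw [him, abs_div, abs_two]
    gcongr
    · exact le_abs_self _
    · linarith [abs_nonneg s.im]
  rw [hL, mul_assoc (C₁ * C₃)]
  gcongr
  · exact h₁ s hs.le hsb
  · exact h₃ _ hs.le hsb

theorem exists_norm_LFunction_inv_le (hχ : χ ≠ 1) {b c : ℝ} (hb : 0 ≤ b) (hbc : b < c)
    (h0 : ∀ s : ℂ, b < s.re → χ.LFunction s ≠ 0) :
    ∃ C : ℝ, 0 ≤ C ∧ ∀ s : ℂ, c ≤ s.re → ‖(χ.LFunction s)⁻¹‖ ≤ Real.exp (C * (1 + |s.im|)) := by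
  obtain ⟨Z, hZ, h2⟩ := exists_norm_LFunction_le_of_two_le_re χ
  -- Borel–Carathéodory is applied on discs centred at m + i Im s, in the region where L and 1/L are
  -- bounded. The outer radius m - b reaches the edge of the zero-free half-plane, and the inner
  -- radius m - c reaches the target line Re s = c.
  set m := max c 2 with hm
  have hmc : c ≤ m := le_max_left _ _
  have hm2 : 2 ≤ m := le_max_right _ _
  obtain ⟨K, hK, hup⟩ := exists_norm_LFunction_le hχ (2 * m)
  set D := |Real.log Z| + 1 with hD
  set R := m - b with hR
  set r := m - c with hr
  have hRr : 0 < R - r := by linarith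
  have hr0 : 0 ≤ r := by linarith
  have hD0 : 0 < D := by positivity
  set M₀ := K + 5 * R + 5 with hM₀
  have hM₀0 : 0 < M₀ := by linarith
  have hpi := Real.pi_pos
  set E₁ := 2 * M₀ * r / (R - r) + (D + Real.pi) * (R + r) / (R - r) with hE₁
  have hE₁0 : 0 ≤ E₁ := by
    have : 0 ≤ R + r := by linarith
    positivity
  refine ⟨E₁ + D, by positivity, fun s hs => ?_⟩
  have ht : (1 : ℝ) ≤ 1 + |s.im| := by linarith [abs_nonneg s.im]
  have hlogZ : ∀ x : ℝ, 0 < x → x ≤ Z → x⁻¹ ≤ Z → |Real.log x| ≤ D := fun x hx h1 h2 => by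
    have e1 := Real.log_le_log hx h1
    have e2 := Real.log_le_log (inv_pos.mpr hx) h2
    rw [Real.log_inv] at e2
    have := le_abs_self (Real.log Z)
    rw [abs_le]
    constructor <;> linarith
  rcases le_total m s.re with hms | hms
  · refine (h2 s (by linarith)).2.trans ?_
    rw [← Real.log_le_iff_le_exp hZ]
    have := le_abs_self (Real.log Z)
    nlinarith
  · set z₀ : ℂ := m + s.im * I with hz₀
    have hz₀re : z₀.re = m := by simp [hz₀]
    have hz₀im : z₀.im = s.im := by simp [hz₀]
    have hball : ∀ z ∈ Metric.ball z₀ R, b < z.re ∧ z.re ≤ 2 * m ∧ |z.im| ≤ |s.im| + R := by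
      intro z hz
      rw [Metric.mem_ball, dist_eq] at hz
      have e1 := (abs_re_le_norm (z - z₀)).trans_lt hz
      have e2 := (abs_im_le_norm (z - z₀)).trans_lt hz
      rw [sub_re, hz₀re] at e1
      rw [sub_im, hz₀im] at e2
      rw [abs_lt] at e1
      have := abs_sub_abs_le_abs_sub z.im s.im
      exact ⟨by linarith [e1.1], by linarith [e1.2], by linarith⟩
    have hc0 : χ.LFunction z₀ ≠ 0 := h0 z₀ (by rw [hz₀re]; linarith)
    have hz₀2 := h2 z₀ (by rw [hz₀re]; exact hm2)
    rw [norm_inv] at hz₀2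
    have hsz : ‖s - z₀‖ ≤ r := by
      have : s - z₀ = ((s.re - m : ℝ) : ℂ) := by apply Complex.ext <;> simp [hz₀]
      rw [this, norm_real, Real.norm_eq_abs, abs_of_nonpos (by linarith)]
      linarith
    refine (norm_inv_le_of_ne_zero_on_ball (M := M₀ * (1 + |s.im|)) (D := D) hr0 (by linarith)
      (by positivity) ((DirichletCharacter.differentiable_LFunction hχ).differentiableOn)
      (fun z hz => h0 z (hball z hz).1) (fun z hz => ?_)
      (hlogZ _ (norm_pos_iff.mpr hc0) hz₀2.1 hz₀2.2) hsz).trans ?_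
    · obtain ⟨e1, e2, e3⟩ := hball z hz
      refine (hup z (by linarith) e2).trans ?_
      have hKe : K ≤ Real.exp K := by linarith [Real.add_one_le_exp K]
      calc K * Real.exp (5 * |z.im|) ≤ Real.exp K * Real.exp (5 * |z.im|) := by gcongr
        _ = Real.exp (K + 5 * |z.im|) := (Real.exp_add _ _).symm
        _ ≤ _ := by
          apply Real.exp_le_exp.mpr
          have := abs_nonneg s.im
          have hR0 : 0 ≤ R := by linarith
          rw [hM₀]
          nlinarith
    · apply Real.exp_le_exp.mpr
      have hA : 0 ≤ 2 * M₀ * r / (R - r) := by positivity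
      have hB : 0 ≤ (D + Real.pi) * (R + r) / (R - r) := by
        have : 0 ≤ R + r := by linarith
        positivity
      have e : 2 * (M₀ * (1 + |s.im|)) * r / (R - r)
          = 2 * M₀ * r / (R - r) * (1 + |s.im|) := by ring
      rw [e, hE₁]
      nlinarith

/-! ### The functional equation -/

theorem inv_apply_eq_conj {N : ℕ} (χ : DirichletCharacter ℂ N) (a : ZMod N) : χ⁻¹ a = conj (χ a) :=
  (MulChar.star_apply' χ a).symm

theorem parity_inv {N : ℕ} (χ : DirichletCharacter ℂ N) : parity χ⁻¹ = parity χ := by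
  have : χ⁻¹.Even ↔ χ.Even := by
    rw [DirichletCharacter.Even, DirichletCharacter.Even, inv_apply_eq_conj]
    constructor <;> intro h
    · simpa using congrArg conj h
    · simp [h]
  simp only [parity]
  split_ifs <;> tauto

theorem conj_ofReal_cpow {x : ℝ} (hx : 0 ≤ x) (z : ℂ) :
    conj ((x : ℂ) ^ z) = (x : ℂ) ^ conj z := by
  rw [cpow_conj _ _ (by rw [arg_ofReal_of_nonneg hx]; exact Real.pi_pos.ne), conj_ofReal]

theorem LFunction_inv_eq_conj (χ : DirichletCharacter ℂ N) {s : ℂ} (hs : 1 < s.re) :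
    χ⁻¹.LFunction s = conj (χ.LFunction (conj s)) := by
  rw [DirichletCharacter.LFunction_eq_LSeries _ hs,
    DirichletCharacter.LFunction_eq_LSeries _ (by simpa using hs), LSeries, LSeries, conj_tsum]
  refine tsum_congr fun n => ?_
  rcases eq_or_ne n 0 with rfl | hn
  · simp
  · rw [LSeries.term_of_ne_zero hn, LSeries.term_of_ne_zero hn, map_div₀, inv_apply_eq_conj,
      ← ofReal_natCast, conj_ofReal_cpow n.cast_nonneg, conj_conj]

/-- Conjugating the Dirichlet series termwise proves this for Re s > 1; the identity theorem extends
it. -/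
theorem xi_inv_eq_conj (hχ : χ ≠ 1) (s : ℂ) : xi χ⁻¹ s = conj (xi χ (conj s)) := by
  have hχ' : χ⁻¹ ≠ 1 := inv_ne_one.mpr hχ
  have hN : (0 : ℝ) ≤ Real.pi / N := by positivity
  have hpole : ∀ (ψ : DirichletCharacter ℂ N) (s : ℂ), 1 < s.re →
      ∀ m : ℕ, (s + parity ψ) / 2 ≠ -m := fun ψ s hs m hm => by
    have h := congrArg re hm
    rw [half_add_parity_re, neg_re, natCast_re] at h
    have h1 : (0 : ℝ) ≤ parity ψ := Nat.cast_nonneg _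
    have h2 : (0 : ℝ) ≤ m := Nat.cast_nonneg _
    linarith
  have hright : ∀ s : ℂ, 1 < s.re → xi χ⁻¹ s = conj (xi χ (conj s)) := fun s hs => by
    have hcs : 1 < (conj s).re := by simpa using hs
    rw [xi_eq hχ' (hpole _ s hs), xi_eq hχ (hpole _ _ hcs), parity_inv, map_mul, map_mul,
      LFunction_inv_eq_conj χ hs, ← Gamma_conj,
      conj_ofReal_cpow hN]
    have h2 : conj (2 : ℂ) = 2 := map_ofNat _ 2
    simp [h2]
  have hd : Differentiable ℂ fun s => conj (xi χ (conj s)) := fun s => by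
    have := ((differentiable_xi hχ) (conj s)).hasDerivAt.conj_conj
    rw [conj_conj] at this
    exact this.differentiableAt
  have hev : xi χ⁻¹ =ᶠ[𝓝 2] fun s => conj (xi χ (conj s)) := by
    filter_upwards [(isOpen_lt continuous_const continuous_re).mem_nhds
      (show (1 : ℝ) < (2 : ℂ).re by norm_num)] with s hs using hright s hs
  exact congrFun (AnalyticOnNhd.eq_of_eventuallyEq
    (fun z _ => (differentiable_xi hχ').analyticAt z) (fun z _ => hd.analyticAt z) hev) s

theorem LFunction_ne_zero_of_one_le_re (hχ : χ ≠ 1) {s : ℂ} (hs : 1 ≤ s.re) :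
    χ.LFunction s ≠ 0 :=
  DirichletCharacter.LFunction_ne_zero_of_one_le_re χ (Or.inl hχ) hs

/-- The functional equation of `ξ(s, χ)`. -/
theorem exists_xi_one_sub_conj (hχp : χ.IsPrimitive) (hχ : χ ≠ 1) :
    ∃ ε : ℂ, ‖ε‖ = 1 ∧ ∀ s : ℂ, xi χ (1 - conj s) = ε * conj (xi χ s) := by
  have hN : (N : ℂ) ≠ 0 := Nat.cast_ne_zero.mpr (NeZero.ne N)
  have hFE : ∀ s : ℂ, xi χ (1 - conj s) = χ.rootNumber * conj (xi χ s) := fun s => by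
    have h1 := xi_inv_eq_conj hχ (conj s)
    rw [conj_conj] at h1
    rw [← h1, xi, xi, hχp.completedLFunction_one_sub, parity_inv, ← mul_assoc, ← mul_assoc,
      ← cpow_add _ _ hN, mul_right_comm]
    have e : (1 - conj s + (parity χ : ℂ)) / 2 + (conj s - 1 / 2) = (conj s + parity χ) / 2 := by
      ring
    rw [e]
    ring
  refine ⟨χ.rootNumber, ?_, hFE⟩
  have hx : xi χ 2 ≠ 0 :=
    xi_ne_zero hχ (by norm_num) (LFunction_ne_zero_of_one_le_re hχ (by norm_num))
  -- Applying the equation twice at a point where ξ does not vanish forces |ε|² = 1.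
  have h := hFE (1 - conj 2)
  rw [hFE 2, map_sub, map_one, conj_conj, sub_sub_cancel, map_mul, conj_conj, ← mul_assoc,
    mul_conj, eq_comm, mul_eq_right₀ hx, normSq_eq_norm_sq] at h
  have h2 : ‖χ.rootNumber‖ ^ 2 = 1 := by exact_mod_cast h
  exact (pow_eq_one_iff_of_nonneg (norm_nonneg _) two_ne_zero).mp h2

/-! ### Comparison of `ξ(s - h, χ)` and `ξ(s + h, χ)` to the right of the critical line -/

/-- Far to the right the L-values and their inverses are bounded, so the quotient is governed by the
Gamma factors, whose arguments differ by exactly h. The bound depends on Re s only. -/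
theorem exists_norm_xi_sub_le_mul (hχ : χ ≠ 1) {h : ℝ} (hh : 0 < h) :
    ∃ K : ℝ, 0 < K ∧ ∀ s : ℂ, h + 2 ≤ s.re →
      ‖xi χ (s - h)‖ ≤ K * (Real.Gamma ((s.re - h + parity χ) / 2) /
        Real.Gamma ((s.re - h + parity χ) / 2 + h)) * ‖xi χ (s + h)‖ := by
  obtain ⟨Z, hZ, hL⟩ := exists_norm_LFunction_le_of_two_le_re χ
  have hq : 0 < Real.pi / N := div_pos Real.pi_pos (Nat.cast_pos.mpr (NeZero.pos N))
  refine ⟨(Real.pi / N) ^ h * (Z * Z), by positivity, fun s hs => ?_⟩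
  have hk : (0 : ℝ) ≤ parity χ := Nat.cast_nonneg _
  have hre1 : (s - h).re = s.re - h := by simp
  have hre2 : (s + h).re = s.re + h := by simp
  rw [norm_xi hχ (s := s - h) (by rw [hre1]; linarith),
    norm_xi hχ (s := s + h) (by rw [hre2]; linarith), hre1, hre2]
  set a : ℂ := (s - h + parity χ) / 2 with ha
  set x : ℝ := (s.re - h + parity χ) / 2 with hx
  have hax : a.re = x := by simp [ha, hx]
  have hx0 : 0 < x := by rw [hx]; linarith
  have hah : (s + h + parity χ) / 2 = a + h := by rw [ha]; ring
  have he : -(s.re - h + parity χ) / 2 = h + -(s.re + h + parity χ) / 2 := by ring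
  rw [hah, he, Real.rpow_add hq]
  have hΓ := norm_Gamma_mul_le (a := a) (by rwa [hax]) hh
  rw [hax] at hΓ
  have hΓx : 0 < Real.Gamma (x + h) := Real.Gamma_pos_of_pos (by positivity)
  have hΓ' : ‖Gamma a‖ ≤ Real.Gamma x / Real.Gamma (x + h) * ‖Gamma (a + h)‖ := by
    rw [div_mul_eq_mul_div, le_div_iff₀ hΓx]
    exact hΓ
  have h1 := (hL (s - h) (by rw [hre1]; linarith)).1
  have h2 := (hL (s + h) (by rw [hre2]; linarith)).2
  have hne : χ.LFunction (s + h) ≠ 0 :=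
    LFunction_ne_zero_of_one_le_re hχ (by rw [hre2]; linarith)
  have h3 : 1 ≤ Z * ‖χ.LFunction (s + h)‖ := by
    rwa [norm_inv, inv_le_iff_one_le_mul₀ (norm_pos_iff.mpr hne)] at h2
  have h4 : ‖χ.LFunction (s - h)‖ ≤ Z * Z * ‖χ.LFunction (s + h)‖ := by
    rw [mul_assoc]
    exact h1.trans (le_mul_of_one_le_right hZ.le h3)
  have hΓ0 : 0 < Real.Gamma x := Real.Gamma_pos_of_pos hx0
  set q := (Real.pi / N) ^ h
  set q' := (Real.pi / N) ^ (-(s.re + h + parity χ) / 2)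
  calc q * q' * ‖Gamma a‖ * ‖χ.LFunction (s - h)‖
      ≤ q * q' * (Real.Gamma x / Real.Gamma (x + h) * ‖Gamma (a + h)‖) *
        (Z * Z * ‖χ.LFunction (s + h)‖) := by gcongr
    _ = _ := by ring

theorem tendsto_xi_quotient_real (hχ : χ ≠ 1) {h : ℝ} (hh : 0 < h) :
    Tendsto (fun x : ℝ => ‖xi χ (x - h)‖ / ‖xi χ (x + h)‖) atTop (𝓝 0) := by
  obtain ⟨K, hK, hle⟩ := exists_norm_xi_sub_le_mul hχ hh
  have harg : Tendsto (fun x : ℝ => (x - h + parity χ) / 2) atTop atTop := by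
    have : Tendsto (fun x : ℝ => x + (-h + parity χ)) atTop atTop :=
      tendsto_atTop_add_const_right _ _ tendsto_id
    refine (this.atTop_div_const two_pos).congr fun x => by ring
  have hlim := ((tendsto_Gamma_div_Gamma_add hh).comp harg).const_mul K
  rw [mul_zero] at hlim
  refine squeeze_zero' (Eventually.of_forall fun x => by positivity) ?_ hlim
  filter_upwards [eventually_ge_atTop (h + 2)] with x hx
  have hne : xi χ (x + h) ≠ 0 :=
    xi_ne_zero hχ (by simp; linarith) (LFunction_ne_zero_of_one_le_re hχ (by simp; linarith))
  rw [div_le_iff₀ (norm_pos_iff.mpr hne)]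
  simpa using hle x (by simpa using hx)

theorem norm_xi_one_sub_conj (hχp : χ.IsPrimitive) (hχ : χ ≠ 1) (s : ℂ) :
    ‖xi χ (1 - conj s)‖ = ‖xi χ s‖ := by
  obtain ⟨ε, hε, h⟩ := exists_xi_one_sub_conj hχp hχ
  rw [h, norm_mul, hε, one_mul, RCLike.norm_conj]

/-- This is the order-one growth that Phragmén–Lindelöf requires. The strict inequality b - 1/2 < h
keeps s + h at a positive distance from the edge of the zero-free half-plane, as the lower bound for
L needs. -/
theorem exists_norm_xi_quotient_le (hχ : χ ≠ 1) {b h : ℝ} (hb : 1 / 2 ≤ b) (hbh : b - 1 / 2 < h)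
    (h0 : ∀ s : ℂ, b < s.re → χ.LFunction s ≠ 0) :
    ∃ C B : ℝ, 0 ≤ B ∧ ∀ s : ℂ, 1 / 2 ≤ s.re →
      ‖xi χ (s - h) / xi χ (s + h)‖ ≤ C * Real.exp (B * ‖s‖) := by
  have hh : 0 < h := by linarith
  have hk : (0 : ℝ) ≤ parity χ := Nat.cast_nonneg _
  have hq : 0 < Real.pi / N := div_pos Real.pi_pos (Nat.cast_pos.mpr (NeZero.pos N))
  obtain ⟨K, hK, hright⟩ := exists_norm_xi_sub_le_mul hχ hh
  -- the region `Re s ≥ T`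
  obtain ⟨X, hX⟩ := eventually_atTop.mp
    ((tendsto_Gamma_div_Gamma_add hh).eventually_le_const one_pos)
  set T := max (h + 2) (2 * X + h) with hT
  have hT1 : h + 2 ≤ T := le_max_left _ _
  have hT2 : 2 * X + h ≤ T := le_max_right _ _
  -- the strip `1 / 2 ≤ Re s ≤ T`
  obtain ⟨C₁, hC₁, h₁⟩ := exists_norm_xi_le hχ (1 / 2 - h) T
  obtain ⟨C₂, hC₂, h₂⟩ := exists_norm_LFunction_inv_le hχ (c := 1 / 2 + h) (by linarith)
    (by linarith) h0
  obtain ⟨C₃, h₃⟩ := exists_norm_Gamma_inv_le ((T + h + parity χ) / 2)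
  set Q := max 1 (Real.pi / N) ^ ((T + h + parity χ) / 2) with hQ
  have hQ0 : 0 ≤ Q := by positivity
  set C := C₁ * Q * |C₃| * Real.exp C₂ with hC
  have hC0 : 0 ≤ C := by positivity
  -- K serves far to the right; in the strip the rate is 5 from 1/Γ plus C₂ from 1/L.
  refine ⟨K + C, 5 + C₂, by positivity, fun s hs => ?_⟩
  have hre : (s + h).re = s.re + h := by simp
  have him : (s + h).im = s.im := by simp
  have hL0 : χ.LFunction (s + h) ≠ 0 := h0 _ (by rw [hre]; linarith)
  have hs0 : 0 < (s + h).re := by rw [hre]; linarith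
  have hne : xi χ (s + h) ≠ 0 := xi_ne_zero hχ hs0 hL0
  have hexp1 : 1 ≤ Real.exp ((5 + C₂) * ‖s‖) := Real.one_le_exp (by positivity)
  rw [norm_div, div_le_iff₀ (norm_pos_iff.mpr hne)]
  rcases le_total T s.re with hsT | hsT
  · refine (hright s (by linarith)).trans (mul_le_mul_of_nonneg_right ?_ (norm_nonneg _))
    have hΓ := hX ((s.re - h + parity χ) / 2) (by linarith)
    calc _ ≤ K * 1 := mul_le_mul_of_nonneg_left hΓ hK.le
      _ ≤ (K + C) * Real.exp ((5 + C₂) * ‖s‖) := by gcongr; linarith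
  · have hnum := h₁ (s - h) (by simp; linarith) (by simp; linarith)
    have hexp : Real.exp (5 * |s.im|) * Real.exp (C₂ * (1 + |s.im|))
        ≤ Real.exp C₂ * Real.exp ((5 + C₂) * ‖s‖) := by
      rw [← Real.exp_add, ← Real.exp_add]
      apply Real.exp_le_exp.mpr
      have := mul_le_mul_of_nonneg_left (abs_im_le_norm s) (by linarith : 0 ≤ 5 + C₂)
      linarith
    have hinv : ‖(xi χ (s + h))⁻¹‖ ≤ Q * |C₃| * Real.exp C₂ * Real.exp ((5 + C₂) * ‖s‖) := by
      have hG : ‖(Gamma ((s + h + parity χ) / 2))⁻¹‖ ≤ |C₃| * Real.exp (5 * |s.im|) := by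
        have hre' := half_add_parity_re (χ := χ) (s + h)
        rw [hre] at hre'
        refine (h₃ _ (by rw [hre']; linarith) (by rw [hre']; linarith)).trans ?_
        have : ((s + h + parity χ) / 2).im = s.im / 2 := by simp
        rw [this, abs_div, abs_two]
        gcongr
        · exact le_abs_self _
        · linarith [abs_nonneg s.im]
      have hLi := h₂ (s + h) (by rw [hre]; linarith)
      rw [him] at hLi
      have hpow : (Real.pi / N) ^ ((s.re + h + parity χ) / 2) ≤ Q :=
        (Real.rpow_le_rpow hq.le (le_max_right 1 _) (by linarith)).trans
          (Real.rpow_le_rpow_of_exponent_le (le_max_left _ _) (by linarith))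
      have e : ‖(xi χ (s + h))⁻¹‖ = (Real.pi / N) ^ ((s.re + h + parity χ) / 2) *
          ‖(Gamma ((s + h + parity χ) / 2))⁻¹‖ * ‖(χ.LFunction (s + h))⁻¹‖ := by
        rw [norm_inv, norm_xi hχ hs0, hre, mul_inv, mul_inv, norm_inv, norm_inv, neg_div,
          Real.rpow_neg hq.le, inv_inv]
      rw [e]
      calc _ ≤ Q * (|C₃| * Real.exp (5 * |s.im|)) * Real.exp (C₂ * (1 + |s.im|)) := by gcongr
        _ = Q * |C₃| * (Real.exp (5 * |s.im|) * Real.exp (C₂ * (1 + |s.im|))) := by ring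
        _ ≤ Q * |C₃| * (Real.exp C₂ * Real.exp ((5 + C₂) * ‖s‖)) := by gcongr
        _ = _ := by ring
    have hmain : ‖xi χ (s - h)‖ * ‖(xi χ (s + h))⁻¹‖ ≤ C * Real.exp ((5 + C₂) * ‖s‖) := by
      calc _ ≤ C₁ * (Q * |C₃| * Real.exp C₂ * Real.exp ((5 + C₂) * ‖s‖)) := by gcongr
        _ = _ := by rw [hC]; ring
    rw [norm_inv, ← div_eq_mul_inv, div_le_iff₀ (norm_pos_iff.mpr hne)] at hmain
    refine hmain.trans ?_
    gcongr
    linarith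

theorem norm_xi_sub_le_of_zero_free (hχp : χ.IsPrimitive) (hχ : χ ≠ 1) {b h : ℝ}
    (hb : 1 / 2 ≤ b) (hbh : b - 1 / 2 < h) (h0 : ∀ s : ℂ, b < s.re → χ.LFunction s ≠ 0)
    {s : ℂ} (hs : 1 / 2 ≤ s.re) : ‖xi χ (s - h)‖ ≤ ‖xi χ (s + h)‖ := by
  have hh : 0 < h := by linarith
  have hne : ∀ s : ℂ, 1 / 2 ≤ s.re → xi χ (s + h) ≠ 0 := fun s hs =>
    xi_ne_zero hχ (by simp; linarith) (h0 _ (by simp; linarith))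
  set F : ℂ → ℂ := fun z => xi χ (1 / 2 + z - h) / xi χ (1 / 2 + z + h) with hF
  have hre : ∀ z : ℂ, (1 / 2 + z).re = 1 / 2 + z.re := fun z => by simp
  have hdx := differentiable_xi hχ
  have hd : DiffContOnCl ℂ F {z | 0 < z.re} := by
    refine DifferentiableOn.diffContOnCl fun z hz => ?_
    have hz' : 0 ≤ z.re := by
      rw [closure_setOfPred_lt_re] at hz
      exact hz
    have hn : DifferentiableAt ℂ (fun z => xi χ (1 / 2 + z - h)) z :=
      (hdx _).comp z (by fun_prop)
    have hm : DifferentiableAt ℂ (fun z => xi χ (1 / 2 + z + h)) z :=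
      (hdx _).comp z (by fun_prop)
    exact (hn.div hm (hne _ (by rw [hre]; linarith))).differentiableWithinAt
  have hPL : ∀ z : ℂ, 0 ≤ z.re → ‖F z‖ ≤ 1 := fun z hz => by
    refine PhragmenLindelof.right_half_plane_of_bounded_on_real hd ?_ ?_ (fun y => ?_) hz
    · obtain ⟨C, B, hB, hle⟩ := exists_norm_xi_quotient_le hχ hb hbh h0
      refine ⟨1, by norm_num, B, Asymptotics.IsBigO.of_bound (|C| * Real.exp (B * (1 / 2))) ?_⟩
      refine eventually_inf_principal.mpr (Eventually.of_forall fun z hz => ?_)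
      have hz : 0 < z.re := hz
      refine (hle (1 / 2 + z) (by rw [hre]; linarith)).trans ?_
      rw [Real.rpow_one, Real.norm_of_nonneg (Real.exp_pos _).le, mul_assoc, ← Real.exp_add,
        ← mul_add]
      have hn : ‖1 / 2 + z‖ ≤ 1 / 2 + ‖z‖ := by
        refine (norm_add_le _ _).trans_eq ?_
        norm_num
      gcongr
      exact le_abs_self C
    · have hlim := (tendsto_xi_quotient_real hχ hh).comp
        (tendsto_atTop_add_const_left atTop (1 / 2 : ℝ) tendsto_id)
      refine (hlim.congr fun x => ?_).isBoundedUnder_le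
      simp [hF]
    -- On the critical line s - h and s + h are mirror images, so the functional equation makes the
    -- quotient unimodular.
    · have e : (1 / 2 + y * I : ℂ) - h = 1 - conj (1 / 2 + y * I + h) := by
        apply Complex.ext <;> simp
        ring
      have hy := hne (1 / 2 + y * I) (by simp)
      rw [hF]
      simp only [norm_div]
      rw [e, norm_xi_one_sub_conj hχp hχ, div_self (norm_ne_zero_iff.mpr hy)]
  have h1 := hPL (s - 1 / 2) (by simpa using hs)
  simp only [hF, add_sub_cancel, norm_div] at h1
  rwa [div_le_one (norm_pos_iff.mpr (hne s hs))] at h1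

/-- Equality at one point would, by the maximum principle, make the quotient unimodular on the whole
half-plane, contradicting its decay along the real axis. -/
theorem norm_xi_sub_lt_of_le (hχ : χ ≠ 1) {h : ℝ} (hh : 0 < h)
    (hne : ∀ s : ℂ, 1 / 2 < s.re → xi χ (s + h) ≠ 0)
    (hle : ∀ s : ℂ, 1 / 2 < s.re → ‖xi χ (s - h)‖ ≤ ‖xi χ (s + h)‖) {s : ℂ} (hs : 1 / 2 < s.re) :
    ‖xi χ (s - h)‖ < ‖xi χ (s + h)‖ := by
  refine lt_of_le_of_ne (hle s hs) fun heq => ?_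
  set U : Set ℂ := {z | 1 / 2 < z.re} with hU
  set F : ℂ → ℂ := fun z => xi χ (z - h) / xi χ (z + h) with hF
  have hdx := differentiable_xi hχ
  have hd : DifferentiableOn ℂ F U := fun z hz => by
    have hn : DifferentiableAt ℂ (fun z => xi χ (z - h)) z := (hdx _).comp z (by fun_prop)
    have hm : DifferentiableAt ℂ (fun z => xi χ (z + h)) z := (hdx _).comp z (by fun_prop)
    exact (hn.div hm (hne z hz)).differentiableWithinAt
  have hFs : ‖F s‖ = 1 := by
    simp only [hF, norm_div]
    rw [heq, div_self (norm_ne_zero_iff.mpr (hne s hs))]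
  have hmax : IsMaxOn (norm ∘ F) U s := fun z hz => by
    change ‖F z‖ ≤ ‖F s‖
    rw [hFs]
    simp only [hF, norm_div]
    exact (div_le_one (norm_pos_iff.mpr (hne z hz))).mpr (hle z hz)
  have hconst := norm_eqOn_of_isPreconnected_of_isMaxOn
    (convex_halfSpace_re_gt (1 / 2)).isPreconnected
    (isOpen_lt continuous_const continuous_re) hd hs hmax
  have hlim : Tendsto (fun x : ℝ => ‖xi χ (x - h)‖ / ‖xi χ (x + h)‖) atTop (𝓝 1) := by
    refine tendsto_const_nhds.congr' ?_
    filter_upwards [eventually_gt_atTop (1 / 2 : ℝ)] with x hx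
    have hxU : (x : ℂ) ∈ U := by simpa [hU] using hx
    have := hconst hxU
    simp only [Function.comp_apply, Function.const_apply, hFs] at this
    rw [← this, hF]
    simp only [norm_div]
  exact one_ne_zero (tendsto_nhds_unique hlim (tendsto_xi_quotient_real hχ hh))

theorem LFunction_ne_zero_of_riemannHypothesis (hχ : χ ≠ 1) (hRH : RiemannHypothesisFor χ) {s : ℂ}
    (hs : 1 / 2 < s.re) : χ.LFunction s ≠ 0 := by
  rcases le_or_gt 1 s.re with h1 | h1
  · exact LFunction_ne_zero_of_one_le_re hχ h1
  · exact fun h => hs.ne' (hRH s (by linarith) h1 h)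

theorem xi_add_ne_zero (hχ : χ ≠ 1) {h : ℝ} (hh : 0 < h)
    (hor : 1 / 2 ≤ h ∨ RiemannHypothesisFor χ) {s : ℂ} (hs : 1 / 2 ≤ s.re) :
    xi χ (s + h) ≠ 0 := by
  refine xi_ne_zero hχ (by simp; linarith) ?_
  rcases hor with h2 | hRH
  · exact LFunction_ne_zero_of_one_le_re hχ (by simp; linarith)
  · exact LFunction_ne_zero_of_riemannHypothesis hχ hRH (by simp; linarith)

theorem norm_xi_sub_lt (hχp : χ.IsPrimitive) (hχ : χ ≠ 1) {h : ℝ} (hh : 0 < h)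
    (hor : 1 / 2 ≤ h ∨ RiemannHypothesisFor χ) {s : ℂ} (hs : 1 / 2 < s.re) :
    ‖xi χ (s - h)‖ < ‖xi χ (s + h)‖ := by
  refine norm_xi_sub_lt_of_le hχ hh (fun s hs => xi_add_ne_zero hχ hh hor hs.le) (fun s hs => ?_) hs
  rcases hor with h2 | hRH
  -- The zero-free half-plane Re s > 1 yields the estimate only for shifts u > 1/2. Letting u
  -- decrease to h includes h = 1/2; the strictness lost in the limit comes from the maximum
  -- principle.
  · have hev : ∀ᶠ u : ℝ in 𝓝[>] h, ‖xi χ (s - u)‖ ≤ ‖xi χ (s + u)‖ := by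
      filter_upwards [self_mem_nhdsWithin] with u hu
      have hu : h < u := hu
      exact norm_xi_sub_le_of_zero_free hχp hχ (b := 1) (by norm_num) (by linarith)
        (fun z hz => LFunction_ne_zero_of_one_le_re hχ hz.le) hs.le
    have hcx := (differentiable_xi hχ).continuous
    have hc1 : Continuous fun u : ℝ => ‖xi χ (s - u)‖ := by fun_prop
    have hc2 : Continuous fun u : ℝ => ‖xi χ (s + u)‖ := by fun_prop
    exact le_of_tendsto_of_tendsto ((hc1.tendsto h).mono_left nhdsWithin_le_nhds)
      ((hc2.tendsto h).mono_left nhdsWithin_le_nhds) hev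
  · exact norm_xi_sub_le_of_zero_free hχp hχ (b := 1 / 2) le_rfl (by linarith)
      (fun z hz => LFunction_ne_zero_of_riemannHypothesis hχ hRH hz) hs.le

/-! ### The functions `A` and `B` -/

theorem differentiable_E (hχ : χ ≠ 1) (h θ : ℝ) : Differentiable ℂ (E χ h θ) := by
  have hd : Differentiable ℂ fun s : ℂ => xi χ (s + h) := fun s =>
    (differentiable_xi hχ _).comp s (by fun_prop)
  exact hd.const_mul _

theorem differentiable_A (hχ : χ ≠ 1) (h θ : ℝ) : Differentiable ℂ (A χ h θ) :=
  ((differentiable_E hχ h θ).add (differentiable_reflect (differentiable_E hχ h θ))).const_mul _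

theorem differentiable_B (hχ : χ ≠ 1) (h θ : ℝ) : Differentiable ℂ (B χ h θ) :=
  ((differentiable_E hχ h θ).sub (differentiable_reflect (differentiable_E hχ h θ))).const_mul _

theorem norm_E (χ : DirichletCharacter ℂ N) (h θ : ℝ) (s : ℂ) : ‖E χ h θ s‖ = ‖xi χ (s + h)‖ := by
  rw [E, norm_mul, mul_comm I, norm_exp_ofReal_mul_I, one_mul]

theorem zeros_of_pos (hχp : χ.IsPrimitive) (hχ : χ ≠ 1) {h : ℝ} (hh : 0 < h)
    (hor : 1 / 2 ≤ h ∨ RiemannHypothesisFor χ) (θ : ℝ) {a b : ℂ → ℂ}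
    (ha : ∀ s, a s = 1 / 2 * (E χ h θ s + reflect (E χ h θ) s))
    (hb : ∀ s, b s = -(1 / (2 * I)) * (E χ h θ s - reflect (E χ h θ) s)) :
    (ZerosOnCriticalLine a ∧ ZerosOnCriticalLine b) ∧ (ZerosSimple a ∧ ZerosSimple b) ∧
      ZerosInterlace a b := by
  refine hermite_biehler (differentiable_E hχ h θ) (fun s hs => ?_) (fun s hs => ?_) ha hb
  · rw [← norm_ne_zero_iff, norm_E, norm_ne_zero_iff]
    exact xi_add_ne_zero hχ hh hor hs.ge
  · have e : 1 - conj s + h = 1 - conj (s - h) := by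
      rw [map_sub, conj_ofReal]
      ring
    rw [norm_E, norm_E, e, norm_xi_one_sub_conj hχp hχ]
    exact norm_xi_sub_lt hχp hχ hh hor hs

/-- The functional equation exchanges h and -h, and its unimodular constant is absorbed into the
angle. -/
theorem exists_E_eq_reflect_E_neg (hχp : χ.IsPrimitive) (hχ : χ ≠ 1) (h θ : ℝ) :
    ∃ θ' : ℝ, E χ h θ = reflect (E χ (-h) θ') := by
  obtain ⟨ε, hε, hFE⟩ := exists_xi_one_sub_conj hχp hχ
  refine ⟨-θ - arg ε, funext fun s => ?_⟩
  have e : 1 - conj s + ((-h : ℝ) : ℂ) = 1 - conj (s + h) := by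
    rw [map_add, conj_ofReal]
    push_cast
    ring
  rw [reflect, E, E, e, hFE, map_mul, map_mul, conj_conj, ← mul_assoc]
  congr 1
  have hε' : ε = exp (arg ε * I) := by
    conv_lhs => rw [← norm_mul_exp_arg_mul_I ε, hε]
    simp
  conv_rhs => rw [hε']
  rw [← exp_conj, ← exp_conj, ← exp_add, map_mul, map_mul, conj_I, conj_ofReal, conj_ofReal]
  congr 1
  push_cast
  rw [← hε']
  ring

theorem reflect_reflect (f : ℂ → ℂ) : reflect (reflect f) = f := by
  funext s
  simp [reflect]

theorem zeros_A_B (hχp : χ.IsPrimitive) (hχ : χ ≠ 1) {h : ℝ} (hh : 0 < |h|)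
    (hor : 1 / 2 ≤ |h| ∨ RiemannHypothesisFor χ) (θ : ℝ) :
    (ZerosOnCriticalLine (A χ h θ) ∧ ZerosOnCriticalLine (B χ h θ)) ∧
      (ZerosSimple (A χ h θ) ∧ ZerosSimple (B χ h θ)) ∧
      ZerosInterlace (A χ h θ) (B χ h θ) := by
  rcases lt_or_gt_of_ne (abs_pos.mp hh) with hneg | hpos
  · rw [abs_of_neg hneg] at hor
    obtain ⟨θ', hE⟩ := exists_E_eq_reflect_E_neg hχp hχ h θ
    -- Exchanging E with its reflection fixes A and changes the sign of B, which leaves the zeros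
    -- and their orders unchanged.
    obtain ⟨⟨h1, h2⟩, ⟨h3, h4⟩, h5⟩ := zeros_of_pos hχp hχ (neg_pos.mpr hneg) hor θ'
      (a := A χ h θ) (b := -B χ h θ)
      (fun s => by
        change 1 / 2 * (E χ h θ s + reflect (E χ h θ) s) = _
        rw [hE, reflect_reflect, add_comm])
      (fun s => by
        change -(-(1 / (2 * I)) * (E χ h θ s - reflect (E χ h θ) s)) = _
        rw [hE, reflect_reflect]
        ring)
    refine ⟨⟨h1, fun s hs => h2 s (by simp [hs])⟩, ⟨h3, fun s hs => ?_⟩, ?_⟩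
    · rw [← analyticOrderAt_neg]
      exact h4 s (by simp [hs])
    · have : zeroOrdinates (-B χ h θ) = zeroOrdinates (B χ h θ) := by
        ext t
        simp [zeroOrdinates]
      rwa [ZerosInterlace, this] at h5
  · rw [abs_of_pos hpos] at hor
    exact zeros_of_pos hχp hχ hpos hor θ (fun _ => rfl) (fun _ => rfl)

end DifferencedL

end

theorem theorem5p1 {N : ℕ} [NeZero N] (χ : DirichletCharacter ℂ N)
    (hχ : χ.IsPrimitive) (hχ1 : χ ≠ 1) :
    (∀ h θ : ℝ, 1 / 2 ≤ |h| →
      (Differentiable ℂ (DifferencedL.A χ h θ) ∧ Differentiable ℂ (DifferencedL.B χ h θ)) ∧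
      (DifferencedL.ZerosOnCriticalLine (DifferencedL.A χ h θ) ∧
        DifferencedL.ZerosOnCriticalLine (DifferencedL.B χ h θ)) ∧
      (DifferencedL.ZerosSimple (DifferencedL.A χ h θ) ∧
        DifferencedL.ZerosSimple (DifferencedL.B χ h θ)) ∧
      DifferencedL.ZerosInterlace (DifferencedL.A χ h θ) (DifferencedL.B χ h θ)) ∧
    (DifferencedL.RiemannHypothesisFor χ → ∀ h θ : ℝ, 0 < |h| → |h| < 1 / 2 →
      (Differentiable ℂ (DifferencedL.A χ h θ) ∧ Differentiable ℂ (DifferencedL.B χ h θ)) ∧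
      (DifferencedL.ZerosOnCriticalLine (DifferencedL.A χ h θ) ∧
        DifferencedL.ZerosOnCriticalLine (DifferencedL.B χ h θ)) ∧
      (DifferencedL.ZerosSimple (DifferencedL.A χ h θ) ∧
        DifferencedL.ZerosSimple (DifferencedL.B χ h θ)) ∧
      DifferencedL.ZerosInterlace (DifferencedL.A χ h θ) (DifferencedL.B χ h θ)) := by
  have hd := fun h θ => And.intro (DifferencedL.differentiable_A hχ1 h θ)
    (DifferencedL.differentiable_B hχ1 h θ)
  exact ⟨fun h θ hh => ⟨hd h θ, DifferencedL.zeros_A_B hχ hχ1 (by linarith) (Or.inl hh) θ⟩,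
    fun hRH h θ hh _ => ⟨hd h θ, DifferencedL.zeros_A_B hχ hχ1 hh (Or.inr hRH) θ⟩⟩
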